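/- Let $G$ be a group. A \emph{hyperbolic triple} of $G$ is a triple $(x,y,z)$ of elements of $G$ with $G=\langle x,y,z\rangle$, $xyz=1$ and $1/o(x)+1/o(y)+1/o(z)<1$, where $o(g)$ is the order of $g$; its \emph{type} is $(o(x),o(y),o(z))$. A \emph{Beauville structure} of $G$ is a pair of hyperbolic triples $(x_1,y_1,z_1)$, $(x_2,y_2,z_2)$ of $G$ such that no non-identity power of $x_1$, $y_1$ or $z_1$ is conjugate in $G$ to a power of $x_2$, $y_2$ or $z_2$. A group possessing a Beauville structure is called a \emph{Beauville group}. For $n\ge 2$ let $2\cdot\mathrm{Sym}(n)$ be the group with generators $t_1,\dots,t_{n-1},z$ and relations $z^2=1$, $t_i^2=z$ for all $i$, $(t_it_j)^2=z$ whenever $|i-j|>1$, and $t_kt_{k+1}t_k=t_{k+1}t_kt_{k+1}$ for $1\le k\le n-2$. It projects to $\mathrm{Sym}(n)$ by $t_i\mapsto (i,i+1)$, $z\mapsto 1$. Let $2\cdot\mathrm{Alt}(n)$ be the preimage of $\mathrm{Alt}(n)$ under this projection. \textbf{Theorem.} Let $n\ge 6$ and $G=2\cdot\mathrm{Alt}(n)$.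 Then $G$, $G/Z(G)$ and $\mathrm{Alt}(n)$ are Beauville groups. Moreover: \begin{enumerate} \item if $n$ is odd, $G$ has a hyperbolic triple of type $(n,3,n)$, and $\mathrm{Alt}(n)$ has a hyperbolic triple of type $(n-2,n-2,5)$; \item if $n$ is even, $G$ has a hyperbolic triple of type $(5,n-1,n-1)$, and $\mathrm{Alt}(n)$ has a hyperbolic triple of type $(\mathrm{lcm}(3,n-3),n-2,3)$. \end{enumerate} -/

import Mathlib

/-- `(x, y, z)` is a hyperbolic triple of the group `G`: it generates `G`, has product `1`, and
`1/o(x) + 1/o(y) + 1/o(z) < 1`. -/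
structure IsHyperbolicTriple {G : Type*} [Group G] (x y z : G) : Prop where
  closure_eq_top : Subgroup.closure {x, y, z} = ⊤
  mul_eq_one : x * y * z = 1
  sum_lt_one : (1 : ℚ) / orderOf x + 1 / orderOf y + 1 / orderOf z < 1

/-- `G` has a hyperbolic triple of type `(k, l, m)`, i.e. with element orders `k`, `l`, `m`. -/
def HasHyperbolicTripleOfType (G : Type*) [Group G] (k l m : ℕ) : Prop :=
  ∃ x y z : G, IsHyperbolicTriple x y z ∧ orderOf x = k ∧ orderOf y = l ∧ orderOf z = m

/-- The triples `(x₁, y₁, z₁)` and `(x₂, y₂, z₂)` form an (unmixed) Beauville structure of `G`: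
both are hyperbolic triples, and no non-identity power of a member of the first is conjugate in `G`
to a power of a member of the second. -/
structure IsBeauvilleStructure {G : Type*} [Group G] (x₁ y₁ z₁ x₂ y₂ z₂ : G) : Prop where
  left : IsHyperbolicTriple x₁ y₁ z₁
  right : IsHyperbolicTriple x₂ y₂ z₂
  not_isConj : ∀ u ∈ ({x₁, y₁, z₁} : Set G), ∀ v ∈ ({x₂, y₂, z₂} : Set G), ∀ a b : ℤ,
    u ^ a ≠ 1 → ¬ IsConj (u ^ a) (v ^ b)

/-- A Beauville group is a group possessing a Beauville structure. -/
def IsBeauvilleGroup (G : Type*) [Group G] : Prop :=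
  ∃ x₁ y₁ z₁ x₂ y₂ z₂ : G, IsBeauvilleStructure x₁ y₁ z₁ x₂ y₂ z₂

namespace DoubleCover

/-- The generators `t_1, …, t_{n-1}, z` of the double cover of `Sym(n)`. The generators `t` are
numbered from `0`, so that `t k` lies over the transposition of the points `k` and `k + 1` of
`Fin n`. -/
inductive Gen (n : ℕ) : Type
  | t (k : Fin (n - 1)) : Gen n
  | z : Gen n

/-- The generator `t k` as an element of the free group. -/
def ft {n : ℕ} (k : Fin (n - 1)) : FreeGroup (Gen n) := FreeGroup.of (Gen.t k)

/-- The generator `z` as an element of the free group. -/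
def fz {n : ℕ} : FreeGroup (Gen n) := FreeGroup.of Gen.z

/-- The relations `z² = 1`, `t_i² = z`, `(t_i t_j)² = z` for `|i - j| > 1`, and
`t_k t_{k+1} t_k = t_{k+1} t_k t_{k+1}`. -/
inductive Rel (n : ℕ) : FreeGroup (Gen n) → Prop
  | z_sq : Rel n (fz ^ 2)
  | t_sq (i : Fin (n - 1)) : Rel n (ft i ^ 2 * fz⁻¹)
  | far (i j : Fin (n - 1)) (h : (i : ℕ) + 1 < j ∨ (j : ℕ) + 1 < i) :
      Rel n ((ft i * ft j) ^ 2 * fz⁻¹)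
  | braid (k l : Fin (n - 1)) (h : (l : ℕ) = k + 1) :
      Rel n (ft k * ft l * ft k * (ft l * ft k * ft l)⁻¹)

/-- The double cover `2·Sym(n)`, given by generators and relations. -/
abbrev TwoSym (n : ℕ) : Type := PresentedGroup {r | Rel n r}

/-- The adjacent transposition of `k` and `k + 1` in `Sym(n)`. -/
def adjSwap {n : ℕ} (k : Fin (n - 1)) : Equiv.Perm (Fin n) :=
  Equiv.swap ⟨k, by omega⟩ ⟨k + 1, by omega⟩

/-- The images of the generators in `Sym(n)`. -/
def genImage {n : ℕ} : Gen n → Equiv.Perm (Fin n)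
  | Gen.t k => adjSwap k
  | Gen.z => 1

theorem lift_genImage_eq_one {n : ℕ} (r : FreeGroup (Gen n)) (hr : r ∈ {r | Rel n r}) :
    FreeGroup.lift genImage r = 1 := by
  rcases hr with _ | i | ⟨i, j, h⟩ | ⟨k, l, h⟩
  · simp [fz, genImage]
  · simp [fz, ft, genImage, adjSwap, sq]
  · have hd : Equiv.Perm.Disjoint (adjSwap i) (adjSwap j) := by
      intro x
      by_cases hx : (x : ℕ) = i ∨ (x : ℕ) = i + 1
      · right
        apply Equiv.swap_apply_of_ne_of_ne <;> (rw [Ne, Fin.ext_iff]; dsimp only; omega)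
      · left
        apply Equiv.swap_apply_of_ne_of_ne <;> (rw [Ne, Fin.ext_iff]; dsimp only; omega)
    simp only [fz, ft, map_mul, map_pow, map_inv, FreeGroup.lift_apply_of, genImage, inv_one,
      mul_one, hd.commute.mul_pow]
    simp [adjSwap, sq]
  · have e : (⟨l, by omega⟩ : Fin n) = ⟨k + 1, by omega⟩ := by simp [h]
    simp only [ft, map_mul, map_inv, FreeGroup.lift_apply_of, genImage, mul_inv_eq_one, adjSwap, e]
    have key : ∀ a b c : Fin n, a ≠ b → a ≠ c → b ≠ c → Equiv.swap a b * Equiv.swap b c *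
        Equiv.swap a b = Equiv.swap b c * Equiv.swap a b * Equiv.swap b c := by
      intro a b c hab hac hbc
      rw [Equiv.swap_mul_swap_mul_swap hab hac, Equiv.swap_comm a b, Equiv.swap_comm b c,
        Equiv.swap_mul_swap_mul_swap hbc.symm hac.symm, Equiv.swap_comm]
    apply key <;> (rw [Ne, Fin.ext_iff]; dsimp only; omega)

/-- The projection `2·Sym(n) → Sym(n)`, sending `t k` to the transposition `(k, k + 1)` and `z`
to `1`. -/
def proj (n : ℕ) : TwoSym n →* Equiv.Perm (Fin n) :=
  PresentedGroup.toGroup (f := genImage) lift_genImage_eq_one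

end DoubleCover

/-- The double cover `2·Alt(n)`: the preimage of `Alt(n)` under the projection
`2·Sym(n) → Sym(n)`. -/
def TwoAlt (n : ℕ) : Subgroup (DoubleCover.TwoSym n) :=
  (alternatingGroup (Fin n)).comap (DoubleCover.proj n)

/-! Write G = 2·Alt(n). Everything takes place in Alt(n), where permutations can be handled
explicitly, and is then lifted to G. Two facts make the lift work. First, the kernel of 2·Sym(n) →
Sym(n) lies in {1, z} with z central (`eq_one_or_eq_zg`). Second, for n ≥ 6 the element z is a
commutator of even elements, and it remains one after each is changed by a factor z. A subgroup of G
that maps onto Alt(n) therefore contains z and is all of G (`eq_top_of_map_projAlt`), so generation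
can be checked in Alt(n). That z ≠ 1 is never needed.

To lift a Beauville structure, one triple must lift with its element orders unchanged, so that a
non-identity power upstairs has a non-identity image. The other triple may be lifted arbitrarily
(`IsBeauvilleStructure.isBeauvilleGroup_of_map`). The quotient G/Z(G) is Alt(n), because Alt(n) has
trivial centre.

The order-preserving triple has the form ([w, g], g w g⁻¹, w⁻¹), where w has odd order and lies over
an n-cycle (n odd) or an (n-1)-cycle (n even). The element g is chosen so that [w, g] lies over a
3-cycle or a 5-cycle, and the defining relations show that [w, g] itself has order 3 or 5. The
second triple lives in Alt(n) only.

Non-conjugacy is decided by counting moved points (`PowersMove`): the counts arising from the two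
triples form disjoint sets. For even n this fails only at n = 8, where n - 3 = 5, and another second
triple is used there. Generation follows by producing the 3-cycles (i, i+1, i+2): a few come from
explicit words in Sym(6), Sym(7) or Sym(8), and the others by conjugating with a long cycle that
shifts the points. -/

open Equiv

/-! ### Calculation in the double cover and the kernel of its projection. -/

namespace DoubleCover

variable {n : ℕ}

/-- The generator `t i`, with the value `1` if `i` is out of range. -/
def tg (n i : ℕ) : TwoSym n := if h : i < n - 1 then PresentedGroup.of (Gen.t ⟨i, h⟩) else 1

/-- The central generator `z`. -/
def zg (n : ℕ) : TwoSym n := PresentedGroup.of Gen.z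

theorem mk_eq_one {r : FreeGroup (Gen n)} (h : Rel n r) :
    PresentedGroup.mk {r | Rel n r} r = 1 := by
  exact PresentedGroup.one_of_mem h

theorem tg_eq {i : ℕ} (h : i + 1 < n) :
    tg n i = PresentedGroup.mk _ (ft ⟨i, by omega⟩) := by
  rw [tg, dif_pos (by omega)]; rfl

theorem zg_eq : zg n = PresentedGroup.mk _ fz := rfl

theorem zg_mul_self : zg n * zg n = 1 := by
  have := mk_eq_one (Rel.z_sq (n := n))
  rwa [map_pow, sq] at this

theorem zg_inv : (zg n)⁻¹ = zg n := inv_eq_of_mul_eq_one_left zg_mul_self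

theorem tg_mul_self {i : ℕ} (h : i + 1 < n) : tg n i * tg n i = zg n := by
  have := mk_eq_one (Rel.t_sq (n := n) ⟨i, by omega⟩)
  rw [map_mul, map_pow, map_inv, mul_inv_eq_one, sq] at this
  rwa [tg_eq h]

theorem commute_zg_tg (i : ℕ) : Commute (zg n) (tg n i) := by
  by_cases h : i + 1 < n
  · rw [← tg_mul_self h]
    exact (Commute.refl _).mul_left (Commute.refl _)
  · rw [tg, dif_neg (by omega)]
    exact Commute.one_right _

theorem closure_tg_zg : Subgroup.closure (insert (zg n) {x | ∃ i, i + 1 < n ∧ x = tg n i}) = ⊤ := by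
  rw [eq_top_iff, ← PresentedGroup.closure_range_of, Subgroup.closure_le]
  rintro _ ⟨_ | k, rfl⟩
  · rename_i k
    refine Subgroup.subset_closure (Or.inr ⟨k, by omega, ?_⟩)
    rw [tg, dif_pos k.2]
  · exact Subgroup.subset_closure (Or.inl rfl)

theorem commute_zg (x : TwoSym n) : Commute (zg n) x := by
  have hx : x ∈ Subgroup.closure (insert (zg n) {x | ∃ i, i + 1 < n ∧ x = tg n i}) := by
    rw [closure_tg_zg]; trivial
  induction hx using Subgroup.closure_induction with
  | mem x hx =>
    rcases hx with rfl | ⟨i, -, rfl⟩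
    · exact Commute.refl _
    · exact commute_zg_tg i
  | one => exact Commute.one_right _
  | mul x y _ _ hx hy => exact hx.mul_right hy
  | inv x _ hx => exact hx.inv_right

theorem tg_inv {i : ℕ} (h : i + 1 < n) : (tg n i)⁻¹ = zg n * tg n i := by
  rw [inv_eq_iff_mul_eq_one, (commute_zg _).eq, ← mul_assoc, tg_mul_self h, zg_mul_self]

theorem tg_far {i j : ℕ} (hij : i + 1 < j) (h : j + 1 < n) :
    tg n j * tg n i = zg n * (tg n i * tg n j) := by
  have := mk_eq_one (Rel.far (n := n) ⟨i, by omega⟩ ⟨j, by omega⟩ (Or.inl hij))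
  rw [map_mul, map_pow, map_inv, mul_inv_eq_one, sq, map_mul, ← tg_eq (show i + 1 < n by omega), ← tg_eq h,
    ← zg_eq] at this
  have h2 := eq_mul_inv_of_mul_eq this
  rw [mul_inv_rev, tg_inv h, tg_inv (show i + 1 < n by omega)] at h2
  rw [h2, (commute_zg (tg n j)).eq, mul_assoc, ← mul_assoc (zg n) (zg n) (tg n i), zg_mul_self,
    one_mul, ← mul_assoc, zg_mul_self, one_mul]

theorem tg_braid {i : ℕ} (h : i + 2 < n) :
    tg n i * tg n (i + 1) * tg n i = tg n (i + 1) * tg n i * tg n (i + 1) := by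
  have := mk_eq_one (Rel.braid (n := n) ⟨i, by omega⟩ ⟨i + 1, by omega⟩ rfl)
  rw [map_mul, map_inv, mul_inv_eq_one] at this
  simpa only [map_mul, ← tg_eq (show i + 1 < n by omega), ← tg_eq h] using this

/-- If `x` passes `y` at the cost of `z ^ a`, turning into `x'`, and so on, the costs add up. -/
theorem twist_mul {x x' x'' y y' : TwoSym n} {a b : ℕ} (h : x * y = zg n ^ a * (y * x'))
    (h' : x' * y' = zg n ^ b * (y' * x'')) :
    x * (y * y') = zg n ^ (a + b) * (y * y' * x'') := by
  have hc : y * zg n ^ b = zg n ^ b * y := (((commute_zg y).pow_left b).eq).symm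
  calc x * (y * y') = zg n ^ a * (y * (x' * y')) := by rw [← mul_assoc, h]; simp only [mul_assoc]
    _ = zg n ^ a * (y * zg n ^ b * (y' * x'')) := by rw [h']; simp only [mul_assoc]
    _ = zg n ^ (a + b) * (y * y' * x'') := by rw [hc, pow_add]; simp only [mul_assoc]

/-- The product `t a * t (a + 1) * ⋯ * t (a + m - 1)`, which lies over the cycle
`(a, a + 1, …, a + m)`. -/
def run (n a : ℕ) : ℕ → TwoSym n
  | 0 => 1
  | m + 1 => run n a m * tg n (a + m)

theorem run_add (a m k : ℕ) : run n a (m + k) = run n a m * run n (a + m) k := by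
  induction k with
  | zero => simp [run]
  | succ k ih => rw [← add_assoc, run, ih, run, mul_assoc, add_assoc]

theorem run_one (a : ℕ) : run n a 1 = tg n a := by simp [run]

theorem tg_mul_run_of_gt {a m i : ℕ} (h : a + m < i) (hi : i + 1 < n) :
    tg n i * run n a m = zg n ^ m * (run n a m * tg n i) := by
  induction m with
  | zero => simp [run]
  | succ m ih =>
    exact twist_mul (ih (by omega)) (by rw [pow_one, tg_far (by omega) hi])

theorem tg_mul_run_of_lt {a m i : ℕ} (h : i + 1 < a) (hm : a + m < n) :
    tg n i * run n a m = zg n ^ m * (run n a m * tg n i) := by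
  induction m with
  | zero => simp [run]
  | succ m ih =>
    refine twist_mul (ih (by omega)) ?_
    rw [pow_one, tg_far (i := i) (j := a + m) (by omega) (by omega), ← mul_assoc (zg n), zg_mul_self,
      one_mul]

/-- This lifts the fact that the cycle (a, …, a+m) conjugates (i, i+1) to (i+1, i+2), keeping track
of the power of z. The generator passes distant letters at the cost of one z each, and the braid
relation turns it into its neighbour at no cost. -/
theorem tg_succ_mul_run {a m i : ℕ} (ha : a ≤ i) (hi : i + 1 < a + m) (hm : a + m < n) :
    tg n (i + 1) * run n a m = zg n ^ m * (run n a m * tg n i) := by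
  obtain ⟨p, rfl⟩ := Nat.exists_eq_add_of_le ha
  obtain ⟨q, rfl⟩ : ∃ q, m = p + (2 + q) := ⟨m - p - 2, by omega⟩
  have e : run n a (p + (2 + q)) =
      run n a p * (tg n (a + p) * tg n (a + p + 1) * run n (a + p + 2) q) := by
    rw [run_add, run_add]; simp [run]
  have h1 := tg_mul_run_of_gt (n := n) (a := a) (m := p) (i := a + p + 1) (by omega) (by omega)
  have h2 : tg n (a + p + 1) * (tg n (a + p) * tg n (a + p + 1)) =
      zg n ^ 0 * (tg n (a + p) * tg n (a + p + 1) * tg n (a + p)) := by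
    rw [pow_zero, one_mul, tg_braid (by omega), mul_assoc]
  have h3 := tg_mul_run_of_lt (n := n) (a := a + p + 2) (m := q) (i := a + p) (by omega) (by omega)
  rw [e, twist_mul h1 (twist_mul h2 h3)]
  -- Only m - 2 letters cost a factor z, and z^(m-2) = z^m.
  congr 1
  rw [show p + (2 + q) = p + (0 + q) + 2 by ring, pow_add _ _ 2, sq, zg_mul_self, mul_one]

theorem run_succ_left (a m : ℕ) : run n a (m + 1) = tg n a * run n (a + 1) m := by
  rw [add_comm, run_add, run_one]

theorem zg_pow_eq (m : ℕ) : zg n ^ m = 1 ∨ zg n ^ m = zg n := by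
  induction m with
  | zero => simp
  | succ m ih => rcases ih with h | h <;> simp [pow_succ, h, zg_mul_self]

theorem zg_pow_even {m : ℕ} (hm : Even m) : zg n ^ m = 1 := by
  obtain ⟨k, rfl⟩ := hm
  rw [← two_mul, pow_mul, sq, zg_mul_self, one_pow]

theorem zg_pow_odd {m : ℕ} (hm : Odd m) : zg n ^ m = zg n := by
  obtain ⟨k, rfl⟩ := hm
  rw [pow_succ, zg_pow_even (even_two_mul k), one_mul]

theorem proj_zg : proj n (zg n) = 1 := by
  rw [zg, proj, PresentedGroup.toGroup.of]; rfl

theorem proj_tg {i : ℕ} (h : i + 1 < n) :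
    proj n (tg n i) = swap ⟨i, by omega⟩ ⟨i + 1, h⟩ := by
  rw [tg, dif_pos (by omega), proj, PresentedGroup.toGroup.of]; rfl

theorem proj_run_apply {a m : ℕ} (h : a + m < n) (x : Fin n) :
    (proj n (run n a m) x : ℕ) =
      if a ≤ x ∧ (x : ℕ) < a + m then (x : ℕ) + 1 else if (x : ℕ) = a + m then a else x := by
  induction m generalizing x with
  | zero => simp only [run, map_one, Perm.one_apply]; split_ifs <;> omega
  | succ m ih =>
    rw [run, map_mul, proj_tg (by omega), Perm.mul_apply, ih (by omega)]
    rw [swap_apply_def]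
    simp only [Fin.ext_iff]
    split_ifs <;> simp_all <;> omega

/-- The subgroup generated by `z` and the `t i` with `i + 1 < k`. -/
def initialSubgroup (n k : ℕ) : Subgroup (TwoSym n) :=
  Subgroup.closure (insert (zg n) {x | ∃ i, i + 1 < k ∧ x = tg n i})

theorem zg_mem (k : ℕ) : zg n ∈ initialSubgroup n k := Subgroup.subset_closure (Or.inl rfl)

theorem tg_mem {k i : ℕ} (h : i + 1 < k) : tg n i ∈ initialSubgroup n k :=
  Subgroup.subset_closure (Or.inr ⟨i, h, rfl⟩)

theorem proj_apply_of_mem {k : ℕ} {w : TwoSym n} (hw : w ∈ initialSubgroup n k)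
    (x : Fin n) (hx : k ≤ x) : proj n w x = x := by
  induction hw using Subgroup.closure_induction with
  | mem w hw =>
    rcases hw with rfl | ⟨i, hi, rfl⟩
    · simp [proj_zg]
    · rw [proj_tg (by omega)]
      apply swap_apply_of_ne_of_ne <;> rw [Ne, Fin.ext_iff] <;> dsimp only <;> omega
  | one => simp
  | mul w w' _ _ h h' => rw [map_mul, Perm.mul_apply, h', h]
  | inv w _ h => rw [map_inv, Perm.inv_eq_iff_eq, h]

/-- The runs ending at the point k represent all left cosets. It is enough that left multiplication
by t_i preserves the given form: t_i lengthens the run if i + 1 = j, shortens it if i = j, and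
otherwise passes through it up to z, unchanged if i + 1 < j and as t_{i-1} if i > j. -/
theorem exists_eq_run_mul {k : ℕ} (hk : k + 1 ≤ n) {w : TwoSym n}
    (hw : w ∈ initialSubgroup n (k + 1)) :
    ∃ j ≤ k, ∃ h ∈ initialSubgroup n k, w = run n j (k - j) * h := by
  have hz : ∀ w : TwoSym n, (∃ j ≤ k, ∃ h ∈ initialSubgroup n k, w = run n j (k - j) * h) →
      ∃ j ≤ k, ∃ h ∈ initialSubgroup n k, zg n * w = run n j (k - j) * h := by
    rintro _ ⟨j, hj, h, hh, rfl⟩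
    exact ⟨j, hj, zg n * h, mul_mem (zg_mem _) hh, by
      rw [← mul_assoc, (commute_zg _).eq, mul_assoc]⟩
  have hzp : ∀ (m : ℕ) (w : TwoSym n),
      (∃ j ≤ k, ∃ h ∈ initialSubgroup n k, w = run n j (k - j) * h) →
      ∃ j ≤ k, ∃ h ∈ initialSubgroup n k, zg n ^ m * w = run n j (k - j) * h := by
    intro m w hw
    rcases zg_pow_eq (n := n) m with h | h <;> rw [h]
    · rwa [one_mul]
    · exact hz w hw
  have ht : ∀ i, i + 1 < k + 1 → ∀ w : TwoSym n,
      (∃ j ≤ k, ∃ h ∈ initialSubgroup n k, w = run n j (k - j) * h) →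
      ∃ j ≤ k, ∃ h ∈ initialSubgroup n k, tg n i * w = run n j (k - j) * h := by
    rintro i hi _ ⟨j, hj, h, hh, rfl⟩
    rcases lt_trichotomy (i + 1) j with hij | rfl | hij
    · rw [← mul_assoc, tg_mul_run_of_lt hij (by omega), mul_assoc, mul_assoc]
      exact hzp _ _ ⟨j, hj, _, mul_mem (tg_mem (by omega)) hh, rfl⟩
    · refine ⟨i, by omega, h, hh, ?_⟩
      rw [← mul_assoc, ← run_succ_left]
      congr 2
      omega
    · rcases (Nat.lt_succ_iff.mp hij).eq_or_lt with rfl | hij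
      · obtain ⟨q, hq⟩ : ∃ q, k - j = q + 1 := ⟨k - j - 1, by omega⟩
        rw [hq, run_succ_left, ← mul_assoc, ← mul_assoc, tg_mul_self (by omega), mul_assoc]
        exact hz _ ⟨j + 1, by omega, h, hh, by rw [show k - (j + 1) = q by omega]⟩
      · obtain ⟨i, rfl⟩ : ∃ i', i = i' + 1 := ⟨i - 1, by omega⟩
        rw [← mul_assoc, tg_succ_mul_run (by omega) (by omega) (by omega), mul_assoc, mul_assoc]
        exact hzp _ _ ⟨j, hj, _, mul_mem (tg_mem (by omega)) hh, rfl⟩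
  induction hw using Subgroup.closure_induction_left with
  | one => exact ⟨k, le_rfl, 1, one_mem _, by simp [run]⟩
  | mul_left x hx y _ h =>
    rcases hx with rfl | ⟨i, hi, rfl⟩
    · exact hz y h
    · exact ht i hi y h
  | inv_mul_cancel x hx y _ h =>
    rcases hx with rfl | ⟨i, hi, rfl⟩
    · rw [zg_inv]
      exact hz y h
    · rw [tg_inv (by omega), mul_assoc]
      exact hz _ (ht i hi y h)

theorem eq_one_or_eq_zg_of_mem {k : ℕ} (hk : k ≤ n) {w : TwoSym n}
    (hw : w ∈ initialSubgroup n k) (h1 : proj n w = 1) : w = 1 ∨ w = zg n := by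
  induction k generalizing w with
  | zero =>
    have : w ∈ Subgroup.zpowers (zg n) := by simpa [initialSubgroup, Subgroup.zpowers_eq_closure] using hw
    obtain ⟨m, rfl⟩ := this
    rcases Int.even_or_odd' m with ⟨l, rfl | rfl⟩ <;>
      simp [zpow_add, zpow_mul, zpow_ofNat, sq, zg_mul_self]
  | succ k ih =>
    obtain ⟨j, hj, h, hh, rfl⟩ := exists_eq_run_mul hk hw
    have h2 := congrArg Fin.val (Perm.congr_fun h1 ⟨k, by omega⟩)
    rw [map_mul, Perm.mul_apply, proj_apply_of_mem hh _ le_rfl,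
      proj_run_apply (by omega)] at h2
    -- The factor h fixes the point k and the run sends k to j, so a trivial image forces j = k.
    obtain rfl : j = k := by
      dsimp at h2
      split_ifs at h2 <;> omega
    rw [Nat.sub_self, run, one_mul] at h1 ⊢
    exact ih (by omega) hh h1

/-- The kernel of the projection `2·Sym(n) → Sym(n)` is `{1, z}`. -/
theorem eq_one_or_eq_zg {w : TwoSym n} (h : proj n w = 1) : w = 1 ∨ w = zg n :=
  eq_one_or_eq_zg_of_mem le_rfl (by rw [initialSubgroup, closure_tg_zg]; trivial) h

/-- The transpositions of neighbouring points. -/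
def adjacentSwaps (n : ℕ) : Set (Perm (Fin n)) :=
  {s | ∃ i, ∃ h : i + 1 < n, s = swap (⟨i, by omega⟩ : Fin n) ⟨i + 1, h⟩}

theorem mclosure_adjacentSwaps (n : ℕ) : Submonoid.closure (adjacentSwaps n) = ⊤ := by
  cases n with
  | zero => exact Subsingleton.elim _ _
  | succ n =>
    rw [eq_top_iff, ← Perm.mclosure_swap_castSucc_succ n]
    apply Submonoid.closure_mono
    rintro _ ⟨i, rfl⟩
    exact ⟨i, by omega, rfl⟩

theorem proj_surjective : Function.Surjective (proj n) := by
  intro σ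
  have hs : σ ∈ Submonoid.closure (adjacentSwaps n) := by rw [mclosure_adjacentSwaps]; trivial
  induction hs using Submonoid.closure_induction with
  | mem s hs =>
    obtain ⟨i, h, rfl⟩ := hs
    exact ⟨tg n i, proj_tg h⟩
  | one => exact ⟨1, map_one _⟩
  | mul s t _ _ hs ht =>
    obtain ⟨x, rfl⟩ := hs
    obtain ⟨y, rfl⟩ := ht
    exact ⟨x * y, map_mul _ _ _⟩

end DoubleCover

/-! ### Lifting triples and Beauville structures along homomorphisms. -/

/-- Orders can only grow when lifted, so the sum of reciprocals can only shrink; an element of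
infinite order has `orderOf` equal to 0 and contributes 1/0 = 0. Generation is exactly what `hf`
supplies. -/
theorem IsHyperbolicTriple.of_map {G A : Type*} [Group G] [Group A] (f : G →* A)
    (hf : ∀ H : Subgroup G, H.map f = ⊤ → H = ⊤) {x y z : G}
    (h : IsHyperbolicTriple (f x) (f y) (f z)) (hm : x * y * z = 1) : IsHyperbolicTriple x y z := by
  have key (u : G) : (1 : ℚ) / orderOf u ≤ 1 / orderOf (f u) := by
    rcases Nat.eq_zero_or_pos (orderOf u) with h0 | h0
    · rw [h0, Nat.cast_zero, div_zero]
      positivity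
    · have hd := orderOf_map_dvd f u
      exact one_div_le_one_div_of_le (by exact_mod_cast Nat.pos_of_dvd_of_pos hd h0)
        (by exact_mod_cast Nat.le_of_dvd h0 hd)
  refine ⟨hf _ ?_, hm, ?_⟩
  · rw [MonoidHom.map_closure, Set.image_insert_eq, Set.image_pair]
    exact h.closure_eq_top
  · exact (add_le_add (add_le_add (key x) (key y)) (key z)).trans_lt h.sum_lt_one

/-- A conjugacy in G maps to one in A, so only one danger remains: a non-identity power in the first
triple might die in A. Equality of orders excludes this. Nothing about orders is required of the
lift of the second triple, whose third member is forced by the product relation. -/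
theorem IsBeauvilleStructure.isBeauvilleGroup_of_map {G A : Type*} [Group G] [Group A] (f : G →* A)
    (hs : Function.Surjective f) (hf : ∀ H : Subgroup G, H.map f = ⊤ → H = ⊤) {x₁ y₁ z₁ : G}
    {x₂ y₂ z₂ : A} (h : IsBeauvilleStructure (f x₁) (f y₁) (f z₁) x₂ y₂ z₂)
    (hm : x₁ * y₁ * z₁ = 1) (ho : ∀ u ∈ ({x₁, y₁, z₁} : Set G), orderOf u = orderOf (f u)) :
    IsBeauvilleGroup G := by
  obtain ⟨x, rfl⟩ := hs x₂
  obtain ⟨y, rfl⟩ := hs y₂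
  have hz : f ((x * y)⁻¹) = z₂ := by
    rw [map_inv, map_mul]
    exact inv_eq_of_mul_eq_one_right h.right.mul_eq_one
  refine ⟨x₁, y₁, z₁, x, y, (x * y)⁻¹, .of_map f hf h.left hm,
    .of_map f hf (hz.symm ▸ h.right) (mul_inv_cancel _), ?_⟩
  intro u hu v hv a b hne hc
  have hu' : f u ∈ ({f x₁, f y₁, f z₁} : Set A) := by
    rcases hu with rfl | rfl | rfl <;> simp
  have hv' : f v ∈ ({f x, f y, z₂} : Set A) := by
    rcases hv with rfl | rfl | rfl
    · simp
    · simp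
    · rw [hz]; simp
  refine h.not_isConj _ hu' _ hv' a b ?_ ?_
  · rwa [Ne, ← orderOf_dvd_iff_zpow_eq_one, ← ho u hu, orderOf_dvd_iff_zpow_eq_one]
  · simpa only [map_zpow] using f.map_isConj hc

theorem IsBeauvilleGroup.of_mulEquiv {G A : Type*} [Group G] [Group A] (e : G ≃* A)
    (h : IsBeauvilleGroup A) : IsBeauvilleGroup G := by
  obtain ⟨x₁, y₁, z₁, x₂, y₂, z₂, h⟩ := h
  refine IsBeauvilleStructure.isBeauvilleGroup_of_map (e : G →* A) e.surjective ?_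
    (x₁ := e.symm x₁) (y₁ := e.symm y₁) (z₁ := e.symm z₁) (x₂ := x₂) (y₂ := y₂) (z₂ := z₂)
    (by simpa using h) ?_ ?_
  · intro H hH
    exact Subgroup.map_injective e.injective
      (hH.trans (Subgroup.map_top_of_surjective _ e.surjective).symm)
  · rw [← map_mul, ← map_mul, h.left.mul_eq_one, map_one]
  · intro u _
    exact (e.orderOf_eq u).symm

/-! ### The projection onto Alt(n) and the centre of the cover. -/

namespace DoubleCover

variable {n : ℕ}

/-- The projection `2·Alt(n) → Alt(n)`. -/
def projAlt (n : ℕ) : TwoAlt n →* alternatingGroup (Fin n) :=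
  (proj n).subgroupComap (alternatingGroup (Fin n))

theorem coe_projAlt (x : TwoAlt n) : (projAlt n x : Perm (Fin n)) = proj n x := rfl

theorem projAlt_surjective : Function.Surjective (projAlt n) :=
  (proj n).subgroupComap_surjective_of_surjective _ proj_surjective

theorem mem_twoAlt {x : TwoSym n} : x ∈ TwoAlt n ↔ Perm.sign (proj n x) = 1 :=
  Iff.rfl

theorem sign_proj_tg {i : ℕ} (h : i + 1 < n) : Perm.sign (proj n (tg n i)) = -1 := by
  rw [proj_tg h, Perm.sign_swap]
  simp [Fin.ext_iff]

theorem zg_mem_twoAlt : zg n ∈ TwoAlt n := by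
  rw [mem_twoAlt, proj_zg, map_one]

/-- No proper subgroup of `2·Alt(n)` projects onto `Alt(n)`, since `z` is a commutator. -/
theorem eq_top_of_map_projAlt (hn : 6 ≤ n) (H : Subgroup (TwoAlt n)) (h : H.map (projAlt n) = ⊤) :
    H = ⊤ := by
  have hker (x : TwoAlt n) (hx : projAlt n x = 1) : (x : TwoSym n) = 1 ∨ (x : TwoSym n) = zg n :=
    eq_one_or_eq_zg (congrArg Subtype.val hx)
  have lift (x : TwoAlt n) : ∃ y ∈ H, (x : TwoSym n) = y ∨ (x : TwoSym n) = zg n * y := by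
    obtain ⟨y, hy, e⟩ : projAlt n x ∈ H.map (projAlt n) := by rw [h]; trivial
    refine ⟨y, hy, ?_⟩
    have := hker (x * y⁻¹) (by rw [map_mul, map_inv, e, mul_inv_cancel])
    simpa [mul_inv_eq_one, mul_inv_eq_iff_eq_mul] using this
  have mem (i j : ℕ) (hi : i + 1 < n) (hj : j + 1 < n) : tg n i * tg n j ∈ TwoAlt n := by
    rw [mem_twoAlt, map_mul, map_mul, sign_proj_tg hi, sign_proj_tg hj]; rfl
  -- The elements t₀t₂ and t₀t₄ commute up to the factor z; the index 4 is where n ≥ 6 enters. Their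
  -- representatives a, b in H differ from them by central factors at most, so [a, b] is still z.
  obtain ⟨a, ha, ea⟩ := lift ⟨_, mem 0 2 (by omega) (by omega)⟩
  obtain ⟨b, hb, eb⟩ := lift ⟨_, mem 0 4 (by omega) (by omega)⟩
  have hz : (⟨zg n, zg_mem_twoAlt⟩ : TwoAlt n) ∈ H := by
    have hab : (a : TwoSym n) * b = zg n * (b * a) := by
      have e1 : (tg n 0 * tg n 2) * (tg n 0 * tg n 4) =
          zg n * ((tg n 0 * tg n 4) * (tg n 0 * tg n 2)) := by
        have h1 := tg_far (n := n) (i := 0) (j := 2) (by omega) (by omega)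
        have h2 := tg_far (n := n) (i := 0) (j := 4) (by omega) (by omega)
        have h3 := tg_far (n := n) (i := 2) (j := 4) (by omega) (by omega)
        have h4 : tg n 2 * tg n 4 = zg n * (tg n 4 * tg n 2) := by
          rw [h3, ← mul_assoc, zg_mul_self, one_mul]
        calc (tg n 0 * tg n 2) * (tg n 0 * tg n 4)
            = tg n 0 * (tg n 2 * tg n 0) * tg n 4 := by simp only [mul_assoc]
          _ = tg n 0 * zg n * (tg n 0 * (tg n 2 * tg n 4)) := by rw [h1]; simp only [mul_assoc]
          _ = zg n * (tg n 0 * ((zg n * (tg n 0 * tg n 4)) * tg n 2)) := by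
            rw [h4, ← (commute_zg (tg n 0)).eq]
            simp only [mul_assoc]
            rw [← mul_assoc (tg n 0) (zg n), ← (commute_zg (tg n 0)).eq]
            simp only [mul_assoc]
          _ = _ := by rw [← h2]; simp only [mul_assoc]
      have c (x y : TwoSym n) : x * (zg n * y) = zg n * (x * y) := by
        rw [← mul_assoc, ← (commute_zg x).eq, mul_assoc]
      have zz (x : TwoSym n) : zg n * (zg n * x) = x := by rw [← mul_assoc, zg_mul_self, one_mul]
      dsimp only at ea eb
      rcases ea with ea | ea <;> rcases eb with eb | eb <;> rw [ea, eb] at e1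
      · exact e1
      · exact mul_left_cancel (a := zg n) (by simpa only [mul_assoc, c, zz] using e1)
      · exact mul_left_cancel (a := zg n) (by simpa only [mul_assoc, c, zz] using e1)
      · simpa only [mul_assoc, c, zz] using e1
    have : (⟨zg n, zg_mem_twoAlt⟩ : TwoAlt n) = a * b * (b * a)⁻¹ := by
      ext
      simp only [Subgroup.coe_mul, Subgroup.coe_inv, hab, mul_inv_cancel_right]
    rw [this]
    exact mul_mem (mul_mem ha hb) (inv_mem (mul_mem hb ha))
  rw [eq_top_iff]
  intro x _
  obtain ⟨y, hy, e | e⟩ := lift x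
  · rwa [Subtype.ext e]
  · rw [show x = ⟨zg n, zg_mem_twoAlt⟩ * y from Subtype.ext e]
    exact mul_mem hz hy

theorem center_twoAlt (hn : 4 ≤ n) : Subgroup.center (TwoAlt n) = (projAlt n).ker := by
  apply le_antisymm
  · intro x hx
    have : projAlt n x ∈ Subgroup.center (alternatingGroup (Fin n)) := by
      rw [Subgroup.mem_center_iff] at hx ⊢
      intro g
      obtain ⟨y, rfl⟩ := projAlt_surjective g
      rw [← map_mul, hx y, map_mul]
    rwa [alternatingGroup.center_eq_bot (by simpa using hn), Subgroup.mem_bot] at this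
  · intro x hx
    rw [Subgroup.mem_center_iff]
    intro g
    ext
    rcases eq_one_or_eq_zg (congrArg Subtype.val hx) with e | e
    · simp [e]
    · simp [e, (commute_zg (g : TwoSym n)).eq]

theorem isBeauvilleGroup_quotient_center (hn : 4 ≤ n)
    (h : IsBeauvilleGroup (alternatingGroup (Fin n))) :
    IsBeauvilleGroup (TwoAlt n ⧸ Subgroup.center (TwoAlt n)) :=
  h.of_mulEquiv ((QuotientGroup.quotientMulEquivOfEq (center_twoAlt hn)).trans
    (QuotientGroup.quotientKerEquivOfSurjective _ projAlt_surjective))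

/-! ### Generating Alt(n) by 3-cycles on consecutive points. -/

/-- The transposition of `i` and `j`, or `1` if one of them is not less than `n`. -/
def sw (n i j : ℕ) : Perm (Fin n) :=
  if h : i < n ∧ j < n then swap ⟨i, h.1⟩ ⟨j, h.2⟩ else 1

theorem sw_eq {i j : ℕ} (hi : i < n) (hj : j < n) : sw n i j = swap ⟨i, hi⟩ ⟨j, hj⟩ :=
  dif_pos ⟨hi, hj⟩

theorem sw_mul_self (i j : ℕ) : sw n i j * sw n i j = 1 := by
  unfold sw; split_ifs <;> simp

/-- The `3`-cycle `(i, j, k)`. -/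
def threeCycle (n i j k : ℕ) : Perm (Fin n) := sw n i j * sw n j k

/-- With s_i = (i, i+1), the hypothesis says s_i s_{i+1} ∈ H, and multiplying these up gives s_0 s_i
∈ H for all i. Reading a word in the s_i letter by letter then shows that x or x s_0 lies in H.
Working in the intersection with Alt(n) lets the sign exclude the second case for even x. -/
theorem alternatingGroup_le_of_threeCycle_mem {H : Subgroup (Perm (Fin n))}
    (h : ∀ i, i + 2 < n → threeCycle n i (i + 1) (i + 2) ∈ H) :
    alternatingGroup (Fin n) ≤ H := by
  -- For n < 2 the permutation `sw n 0 1` takes its default value 1, and the sign argument would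
  -- break down.
  rcases lt_or_ge n 2 with hn | hn
  · have : Subsingleton (Fin n) := by
      rw [Fin.subsingleton_iff_le_one]; omega
    intro x _
    rw [Subsingleton.elim x 1]
    exact one_mem _
  have h0 (i : ℕ) (hi : i + 1 < n) : sw n 0 1 * sw n i (i + 1) ∈ H ⊓ alternatingGroup (Fin n) := by
    induction i with
    | zero => rw [sw_mul_self]; exact one_mem _
    | succ i ih =>
      have h1 : threeCycle n i (i + 1) (i + 2) ∈ H ⊓ alternatingGroup (Fin n) := by
        refine ⟨h i hi, ?_⟩
        change Perm.sign _ = 1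
        rw [threeCycle, sw_eq (by omega) (by omega), sw_eq (by omega) hi, map_mul,
          Perm.sign_swap (by simp), Perm.sign_swap (by simp)]
        rfl
      have := mul_mem (ih (by omega)) h1
      rwa [threeCycle, ← mul_assoc, mul_assoc _ _ (sw n i (i + 1)), sw_mul_self, mul_one] at this
  have h2 (i : ℕ) (hi : i + 1 < n) : sw n i (i + 1) * sw n 0 1 ∈ H ⊓ alternatingGroup (Fin n) := by
    have := inv_mem (h0 i hi)
    rwa [mul_inv_rev, inv_eq_of_mul_eq_one_left (sw_mul_self _ _),
      inv_eq_of_mul_eq_one_left (sw_mul_self _ _)] at this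
  have key (x : Perm (Fin n)) : x ∈ H ⊓ alternatingGroup (Fin n) ∨
      x * sw n 0 1 ∈ H ⊓ alternatingGroup (Fin n) := by
    have hx : x ∈ Submonoid.closure (adjacentSwaps n) := by rw [mclosure_adjacentSwaps]; trivial
    induction hx using Submonoid.closure_induction_right with
    | one => exact Or.inl (one_mem _)
    | mul_right x _ s hs ih =>
      obtain ⟨i, hi, rfl⟩ := hs
      rw [← sw_eq]
      rcases ih with ih | ih
      · right
        rw [mul_assoc]
        exact mul_mem ih (h2 i hi)
      · left
        have := mul_mem ih (h0 i hi)
        rwa [← mul_assoc, mul_assoc x, sw_mul_self, mul_one] at this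
  intro x hx
  rcases key x with h | h
  · exact h.1
  · have h3 : Perm.sign (x * sw n 0 1) = 1 := h.2
    rw [map_mul, show Perm.sign x = 1 from hx, sw_eq (by omega) (by omega),
      Perm.sign_swap (by simp)] at h3
    exact absurd h3 (by decide)

/-! ### Powers of cycles on consecutive points and the number of points they move. -/

/-- The cycle `(a, a + 1, …, a + m)`. -/
def cyc (n a m : ℕ) : Perm (Fin n) := proj n (run n a m)

theorem cyc_apply {a m : ℕ} (h : a + m < n) (x : Fin n) :
    (cyc n a m x : ℕ) =
      if a ≤ x ∧ (x : ℕ) < a + m then (x : ℕ) + 1 else if (x : ℕ) = a + m then a else x :=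
  proj_run_apply h x

theorem cyc_pow_apply {a m : ℕ} (h : a + m < n) (j : ℕ) (x : Fin n) :
    ((cyc n a m ^ j) x : ℕ) =
      if a ≤ x ∧ (x : ℕ) ≤ a + m then a + (x - a + j) % (m + 1) else x := by
  induction j with
  | zero =>
    rw [pow_zero, Perm.one_apply]
    split_ifs with hx
    · rw [add_zero, Nat.mod_eq_of_lt (by omega)]
      omega
    · rfl
  | succ j ih =>
    rw [pow_succ', Perm.mul_apply, cyc_apply h, ih]
    by_cases hx : a ≤ (x : ℕ) ∧ (x : ℕ) ≤ a + m
    · simp only [if_pos hx]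
      have h1 : (x - a + (j + 1)) % (m + 1) = ((x - a + j) % (m + 1) + 1) % (m + 1) := by
        rw [Nat.mod_add_mod, add_assoc]
      have h2 : (x - a + j) % (m + 1) < m + 1 := Nat.mod_lt _ (Nat.succ_pos m)
      rw [h1]
      rcases (Nat.lt_succ_iff.mp h2).eq_or_lt with h3 | h3
      · rw [h3, Nat.mod_self, if_neg (by omega), if_pos rfl, add_zero]
      · rw [Nat.mod_eq_of_lt (show (x - a + j) % (m + 1) + 1 < m + 1 by omega), if_pos (by omega)]
        omega
    · simp only [if_neg hx]
      rw [if_neg (by omega), if_neg (by omega)]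

theorem cyc_pow_apply_eq_iff {a m : ℕ} (h : a + m < n) (j : ℕ) (x : Fin n) :
    (cyc n a m ^ j) x = x ↔ (a ≤ (x : ℕ) ∧ (x : ℕ) ≤ a + m → m + 1 ∣ j) := by
  rw [Fin.ext_iff, cyc_pow_apply h]
  split_ifs with hx
  · simp only [hx, and_self, true_imp_iff]
    have h1 : (x : ℕ) = a + (x - a) % (m + 1) := by
      rw [Nat.mod_eq_of_lt (by omega)]; omega
    conv_lhs => rhs; rw [h1]
    rw [Nat.add_left_cancel_iff, ← Nat.ModEq, Nat.ModEq.comm, ← Nat.modEq_zero_iff_dvd]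
    constructor
    · intro h2
      exact (Nat.ModEq.add_left_cancel' (x - a : ℕ) h2).symm
    · intro h2
      exact (Nat.ModEq.add_left _ h2).symm
  · simp [hx]

theorem cyc_pow_eq_one_iff {a m : ℕ} (h : a + m < n) (j : ℕ) :
    cyc n a m ^ j = 1 ↔ m + 1 ∣ j := by
  constructor
  · intro h1
    exact (cyc_pow_apply_eq_iff h j ⟨a, by omega⟩).mp (by rw [h1, Perm.one_apply])
      ⟨le_rfl, Nat.le_add_right _ _⟩
  · intro h1
    ext x
    rw [(cyc_pow_apply_eq_iff h j x).mpr fun _ => h1, Perm.one_apply]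

theorem orderOf_cyc {a m : ℕ} (h : a + m < n) : orderOf (cyc n a m) = m + 1 :=
  Nat.dvd_right_iff_eq.mp fun j => by rw [orderOf_dvd_iff_pow_eq_one, cyc_pow_eq_one_iff h]

/-- A power of the cycle acts on its m + 1 points as a rotation, and a rotation with one fixed point
is trivial. -/
theorem card_support_cyc_pow {a m j : ℕ} (h : a + m < n) (hj : cyc n a m ^ j ≠ 1) :
    (cyc n a m ^ j).support.card = m + 1 := by
  rw [Ne, cyc_pow_eq_one_iff h] at hj
  have : (cyc n a m ^ j).support.map Fin.valEmbedding = Finset.Icc a (a + m) := by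
    ext y
    simp only [Finset.mem_map, Perm.mem_support, Ne, cyc_pow_apply_eq_iff h, Fin.valEmbedding_apply,
      Finset.mem_Icc, hj, imp_false, not_not]
    constructor
    · rintro ⟨x, hx, rfl⟩
      exact hx
    · intro hy
      exact ⟨⟨y, by omega⟩, hy, rfl⟩
  rw [← Finset.card_map Fin.valEmbedding, this, Nat.card_Icc]
  omega

/-- All non-identity powers of `u` move a number of points that lies in `S`. -/
def PowersMove {α : Type*} [DecidableEq α] [Fintype α] (S : Set ℕ) (u : Perm α) : Prop :=
  ∀ j : ℤ, u ^ j ≠ 1 → (u ^ j).support.card ∈ S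

theorem PowersMove.mono {α : Type*} [DecidableEq α] [Fintype α] {S T : Set ℕ} {u : Perm α}
    (h : PowersMove S u) (hST : S ⊆ T) : PowersMove T u := fun j hj => hST (h j hj)

theorem PowersMove.inv {α : Type*} [DecidableEq α] [Fintype α] {S : Set ℕ} {u : Perm α}
    (h : PowersMove S u) : PowersMove S u⁻¹ := fun j hj => by
  rw [inv_zpow'] at hj ⊢
  exact h _ hj

theorem PowersMove.conj {α : Type*} [DecidableEq α] [Fintype α] {S : Set ℕ} {u : Perm α}
    (h : PowersMove S u) (g : Perm α) : PowersMove S (g * u * g⁻¹) := fun j hj => by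
  rw [conj_zpow] at hj ⊢
  rw [Perm.card_support_conj]
  refine h _ fun h1 => hj ?_
  rw [h1, mul_one, mul_inv_cancel]

theorem PowersMove.of_pow {α : Type*} [DecidableEq α] [Fintype α] {S : Set ℕ} {u : Perm α}
    (h : ∀ j : ℕ, u ^ j ≠ 1 → (u ^ j).support.card ∈ S) : PowersMove S u := by
  rintro (j | j) hj
  · simp only [Int.ofNat_eq_natCast, zpow_natCast] at hj ⊢
    exact h j hj
  · rw [zpow_negSucc] at hj ⊢
    rw [Perm.support_inv]
    exact h _ fun h1 => hj (by rw [h1, inv_one])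

theorem powersMove_cyc {a m : ℕ} (h : a + m < n) : PowersMove {m + 1} (cyc n a m) :=
  .of_pow fun _ hj => card_support_cyc_pow h hj

/-- The exponent may kill v, kill u, or kill neither; the three parts of the union correspond to
these cases. -/
theorem PowersMove.mul {α : Type*} [DecidableEq α] [Fintype α] {S T : Set ℕ} {u v : Perm α}
    (hu : PowersMove S u) (hv : PowersMove T v) (h : u.Disjoint v) :
    PowersMove (S ∪ T ∪ {k | ∃ s ∈ S, ∃ t ∈ T, k = s + t}) (u * v) := fun j hj => by
  rw [h.commute.mul_zpow] at hj ⊢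
  rw [(h.zpow_disjoint_zpow j j).card_support_mul]
  by_cases h1 : u ^ j = 1
  · rw [h1, one_mul] at hj
    left; right
    simpa [h1] using hv j hj
  · by_cases h2 : v ^ j = 1
    · left; left
      simpa [h2] using hu j h1
    · right
      exact ⟨_, hu j h1, _, hv j h2, rfl⟩

theorem disjoint_cyc {a m b k : ℕ} (hab : a + m < b) (hb : b + k < n) :
    (cyc n a m).Disjoint (cyc n b k) := by
  intro x
  by_cases hx : (x : ℕ) ≤ a + m
  · right
    ext
    rw [cyc_apply hb]
    split_ifs <;> omega
  · left
    ext
    rw [cyc_apply (by omega)]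
    split_ifs <;> omega

/-! ### Generation criteria: conjugation by shifts and explicit words on few points. -/

theorem conj_sw {i j i' j' : ℕ} (X : Perm (Fin n)) (hi : i < n) (hj : j < n)
    (hi' : (X ⟨i, hi⟩ : ℕ) = i') (hj' : (X ⟨j, hj⟩ : ℕ) = j') :
    X * sw n i j * X⁻¹ = sw n i' j' := by
  subst hi' hj'
  rw [sw_eq hi hj, sw_eq (X _).2 (X _).2, mul_swap_eq_swap_mul, mul_inv_cancel_right]

theorem conj_threeCycle {i j k i' j' k' : ℕ} (X : Perm (Fin n)) (hi : i < n) (hj : j < n)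
    (hk : k < n) (hi' : (X ⟨i, hi⟩ : ℕ) = i') (hj' : (X ⟨j, hj⟩ : ℕ) = j')
    (hk' : (X ⟨k, hk⟩ : ℕ) = k') :
    X * threeCycle n i j k * X⁻¹ = threeCycle n i' j' k' := by
  rw [threeCycle, threeCycle, ← conj_sw X hi hj hi' hj', ← conj_sw X hj hk hj' hk']
  group

/-- Conjugation by X moves each 3-cycle of consecutive points one step up, so a single one starts
the induction. -/
theorem threeCycle_mem_of_shift {H : Subgroup (Perm (Fin n))} {X : Perm (Fin n)} (hX : X ∈ H)
    {a : ℕ} (hs : ∀ x : Fin n, a ≤ x → (x : ℕ) + 1 < n → (X x : ℕ) = x + 1)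
    (ha : threeCycle n a (a + 1) (a + 2) ∈ H) (i : ℕ) (hai : a ≤ i) (hi : i + 2 < n) :
    threeCycle n i (i + 1) (i + 2) ∈ H := by
  induction i, hai using Nat.le_induction with
  | base => exact ha
  | succ i hai ih =>
    rw [← conj_threeCycle (i := i) (j := i + 1) (k := i + 2) X (by omega) (by omega) (by omega)
      (hs _ hai (by dsimp; omega)) (hs _ (by dsimp; omega) (by dsimp; omega))
      (hs _ (by dsimp; omega) (by dsimp; omega))]
    exact mul_mem (mul_mem hX (ih (by omega))) (inv_mem hX)

/-- Permutations of the first `k` points as permutations of `n ≥ k` points. -/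
noncomputable def extend {k : ℕ} (h : k ≤ n) : Perm (Fin k) →* Perm (Fin n) :=
  Perm.viaEmbeddingHom (Fin.castLEEmb h)

theorem extend_sw {k i j : ℕ} (h : k ≤ n) (hi : i < k) (hj : j < k) :
    extend h (sw k i j) = sw n i j := by
  rw [sw_eq hi hj, sw_eq (by omega) (by omega)]
  ext x
  rw [extend, Perm.viaEmbeddingHom_apply]
  by_cases hx : (x : ℕ) < k
  · have e : x = Fin.castLEEmb h ⟨x, hx⟩ := rfl
    rw [e, Perm.viaEmbedding_apply, swap_apply_def, swap_apply_def]
    simp only [Fin.ext_iff, Fin.castLEEmb_apply, Fin.val_castLE]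
    split_ifs <;> rfl
  · rw [Perm.viaEmbedding_apply_of_notMem, swap_apply_of_ne_of_ne]
    · rw [Ne, Fin.ext_iff]; dsimp only; omega
    · rw [Ne, Fin.ext_iff]; dsimp only; omega
    · rintro ⟨y, rfl⟩
      exact hx y.2

theorem sign_cyc {a m : ℕ} (h : a + m < n) : Perm.sign (cyc n a m) = (-1) ^ m := by
  induction m with
  | zero => simp [cyc, run]
  | succ m ih =>
    have := ih (by omega)
    rw [cyc] at this ⊢
    rw [run, map_mul, map_mul, this, sign_proj_tg (by omega), pow_succ]

theorem cyc_zero (a : ℕ) : cyc n a 0 = 1 := by rw [cyc, run, map_one]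

theorem cyc_succ {a m : ℕ} (h : a + m + 1 < n) :
    cyc n a (m + 1) = cyc n a m * sw n (a + m) (a + m + 1) := by
  rw [cyc, run, map_mul, proj_tg h, sw_eq (by omega) h, cyc]

theorem cyc_succ_left {a m : ℕ} (h : a + 1 < n) :
    cyc n a (m + 1) = sw n a (a + 1) * cyc n (a + 1) m := by
  rw [cyc, run_succ_left, map_mul, proj_tg h, sw_eq (by omega) h, cyc]

theorem orderOf_conj' {G : Type*} [Group G] (g x : G) : orderOf (g * x * g⁻¹) = orderOf x :=
  (MulAut.conj g).orderOf_eq x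

theorem conj_mul' {G : Type*} [Group G] (g x y : G) :
    g * (x * y) * g⁻¹ = (g * x * g⁻¹) * (g * y * g⁻¹) := by group

theorem cyc_two (h : 3 ≤ n) : cyc n 0 2 = threeCycle n 0 1 2 := by
  rw [cyc_succ h, cyc_succ (by omega), cyc_zero, one_mul]; rfl

theorem cyc_four (h : 5 ≤ n) :
    cyc n 0 4 = sw n 0 1 * sw n 1 2 * sw n 2 3 * sw n 3 4 := by
  rw [cyc_succ h, cyc_succ (by omega), cyc_succ (by omega), cyc_succ (by omega), cyc_zero, one_mul]

theorem extend_threeCycle {k i j l : ℕ} (h : k ≤ n) (hi : i < k) (hj : j < k) (hl : l < k) :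
    extend h (threeCycle k i j l) = threeCycle n i j l := by
  rw [threeCycle, map_mul, extend_sw h hi hj, extend_sw h hj hl, threeCycle]

/-- The 5-cycle and its conjugate under X move only the points 0, …, 5. The 3-cycles (0, 1, 2) and
(1, 2, 3) are words in these two, whatever n is, and X shifts the points from 1 on. -/
theorem alternatingGroup_le_of_fiveCycle (hn : 6 ≤ n) {H : Subgroup (Perm (Fin n))}
    (hX : cyc n 1 (n - 2) ∈ H) (hY : sw n 0 2 * sw n 3 4 * (sw n 0 1 * sw n 2 3) ∈ H) :
    alternatingGroup (Fin n) ≤ H := by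
  set X := cyc n 1 (n - 2) with hXdef
  have hs (x : Fin n) (h1 : 1 ≤ (x : ℕ)) (h2 : (x : ℕ) + 1 < n) : (X x : ℕ) = x + 1 := by
    rw [hXdef, cyc_apply (by omega), if_pos (by omega)]
  have h0 : (X ⟨0, by omega⟩ : ℕ) = 0 := by
    rw [hXdef, cyc_apply (by omega), if_neg (by dsimp; omega), if_neg (by dsimp; omega)]
  have s (i : ℕ) (h1 : 1 ≤ i) (h2 : i + 1 < n) : (X ⟨i, by omega⟩ : ℕ) = i + 1 := hs _ h1 h2
  have hY' : sw n 0 3 * sw n 4 5 * (sw n 0 2 * sw n 3 4) ∈ H := by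
    have := mul_mem (mul_mem hX hY) (inv_mem hX)
    rwa [conj_mul', conj_mul', conj_mul',
      conj_sw X (by omega) (by omega) h0 (s 2 (by omega) (by omega)),
      conj_sw X (by omega) (by omega) (s 3 (by omega) (by omega)) (s 4 (by omega) (by omega)),
      conj_sw X (by omega) (by omega) h0 (s 1 (by omega) (by omega)),
      conj_sw X (by omega) (by omega) (s 2 (by omega) (by omega)) (s 3 (by omega) (by omega))]
      at this
  have hA : sw 6 0 2 * sw 6 3 4 * (sw 6 0 1 * sw 6 2 3) ∈ H.comap (extend hn) := by
    simpa [extend_sw] using hY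
  have hB : sw 6 0 3 * sw 6 4 5 * (sw 6 0 2 * sw 6 3 4) ∈ H.comap (extend hn) := by
    simpa [extend_sw] using hY'
  set A := sw 6 0 2 * sw 6 3 4 * (sw 6 0 1 * sw 6 2 3) with hAdef
  set B := sw 6 0 3 * sw 6 4 5 * (sw 6 0 2 * sw 6 3 4) with hBdef
  -- Identities in Sym(6), verified by evaluation and carried to Sym(n) by `extend`.
  have e1 : threeCycle 6 0 1 2 = A * B * A * B⁻¹ * A * B⁻¹ := by decide +kernel
  have e2 : threeCycle 6 1 2 3 = B⁻¹ * A⁻¹ * A⁻¹ * B * B := by decide +kernel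
  have m1 : threeCycle n 0 1 2 ∈ H := by
    rw [← extend_threeCycle hn (by omega) (by omega) (by omega), ← Subgroup.mem_comap, e1]
    exact mul_mem (mul_mem (mul_mem (mul_mem (mul_mem hA hB) hA) (inv_mem hB)) hA) (inv_mem hB)
  have m2 : threeCycle n 1 2 3 ∈ H := by
    rw [← extend_threeCycle hn (by omega) (by omega) (by omega), ← Subgroup.mem_comap, e2]
    exact mul_mem (mul_mem (mul_mem (mul_mem (inv_mem hB) (inv_mem hA)) (inv_mem hA)) hB) hB
  refine alternatingGroup_le_of_threeCycle_mem fun i hi => ?_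
  rcases Nat.eq_zero_or_pos i with rfl | h
  · exact m1
  · exact threeCycle_mem_of_shift hX hs m2 i h hi

/-- The 5-cycle and its conjugates under X and X² live on seven points and yield (2, 3, 4). The long
cycle shifts this upwards; the 5-cycle shifts it down to (1, 2, 3) and (0, 1, 2). -/
theorem alternatingGroup_le_of_cyc_four (hn : 7 ≤ n) {H : Subgroup (Perm (Fin n))}
    (hX : cyc n 2 (n - 3) ∈ H) (hY : cyc n 0 4 ∈ H) : alternatingGroup (Fin n) ≤ H := by
  set X := cyc n 2 (n - 3) with hXdef
  have hs (x : Fin n) (h1 : 2 ≤ (x : ℕ)) (h2 : (x : ℕ) + 1 < n) : (X x : ℕ) = x + 1 := by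
    rw [hXdef, cyc_apply (by omega), if_pos (by omega)]
  have h0 (i : ℕ) (h1 : i < 2) : (X ⟨i, by omega⟩ : ℕ) = i := by
    rw [hXdef, cyc_apply (by omega), if_neg (by dsimp; omega), if_neg (by dsimp; omega)]
  have s (i : ℕ) (h1 : 2 ≤ i) (h2 : i + 1 < n) : (X ⟨i, by omega⟩ : ℕ) = i + 1 := hs _ h1 h2
  have hY1 : sw n 0 1 * sw n 1 3 * sw n 3 4 * sw n 4 5 ∈ H := by
    rw [cyc_four (by omega)] at hY
    have := mul_mem (mul_mem hX hY) (inv_mem hX)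
    rwa [conj_mul', conj_mul', conj_mul',
      conj_sw X (by omega) (by omega) (h0 0 (by omega)) (h0 1 (by omega)),
      conj_sw X (by omega) (by omega) (h0 1 (by omega)) (s 2 (by omega) (by omega)),
      conj_sw X (by omega) (by omega) (s 2 (by omega) (by omega)) (s 3 (by omega) (by omega)),
      conj_sw X (by omega) (by omega) (s 3 (by omega) (by omega)) (s 4 (by omega) (by omega))]
      at this
  have hY2 : sw n 0 1 * sw n 1 4 * sw n 4 5 * sw n 5 6 ∈ H := by
    have := mul_mem (mul_mem hX hY1) (inv_mem hX)
    rwa [conj_mul', conj_mul', conj_mul',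
      conj_sw X (by omega) (by omega) (h0 0 (by omega)) (h0 1 (by omega)),
      conj_sw X (by omega) (by omega) (h0 1 (by omega)) (s 3 (by omega) (by omega)),
      conj_sw X (by omega) (by omega) (s 3 (by omega) (by omega)) (s 4 (by omega) (by omega)),
      conj_sw X (by omega) (by omega) (s 4 (by omega) (by omega)) (s 5 (by omega) (by omega))]
      at this
  have hA : sw 7 0 1 * sw 7 1 2 * sw 7 2 3 * sw 7 3 4 ∈ H.comap (extend hn) := by
    simpa [extend_sw, cyc_four (show 5 ≤ n by omega)] using hY
  have hB : sw 7 0 1 * sw 7 1 3 * sw 7 3 4 * sw 7 4 5 ∈ H.comap (extend hn) := by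
    simpa [extend_sw] using hY1
  have hC : sw 7 0 1 * sw 7 1 4 * sw 7 4 5 * sw 7 5 6 ∈ H.comap (extend hn) := by
    simpa [extend_sw] using hY2
  set A := sw 7 0 1 * sw 7 1 2 * sw 7 2 3 * sw 7 3 4 with hAdef
  set B := sw 7 0 1 * sw 7 1 3 * sw 7 3 4 * sw 7 4 5 with hBdef
  set C := sw 7 0 1 * sw 7 1 4 * sw 7 4 5 * sw 7 5 6 with hCdef
  have e2 : threeCycle 7 2 3 4 = A⁻¹ * C * A * C⁻¹ * A⁻¹ * B⁻¹ := by decide +kernel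
  have e1 : threeCycle 7 1 2 3 = A⁻¹ * threeCycle 7 2 3 4 * A := by decide +kernel
  have e0 : threeCycle 7 0 1 2 = A⁻¹ * threeCycle 7 1 2 3 * A := by decide +kernel
  have m2 : threeCycle 7 2 3 4 ∈ H.comap (extend hn) := by
    rw [e2]
    exact mul_mem (mul_mem (mul_mem (mul_mem (mul_mem (inv_mem hA) hC) hA) (inv_mem hC))
      (inv_mem hA)) (inv_mem hB)
  have m1 : threeCycle 7 1 2 3 ∈ H.comap (extend hn) := by
    rw [e1]
    exact mul_mem (mul_mem (inv_mem hA) m2) hA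
  have m0 : threeCycle 7 0 1 2 ∈ H.comap (extend hn) := by
    rw [e0]
    exact mul_mem (mul_mem (inv_mem hA) m1) hA
  rw [Subgroup.mem_comap, extend_threeCycle hn (by omega) (by omega) (by omega)] at m0 m1 m2
  refine alternatingGroup_le_of_threeCycle_mem fun i hi => ?_
  obtain rfl | rfl | h : i = 0 ∨ i = 1 ∨ 2 ≤ i := by omega
  · exact m0
  · exact m1
  · exact threeCycle_mem_of_shift hX hs m2 i h hi

theorem cyc_mul_cyc_eq (hn : 6 ≤ n) :
    cyc n 0 1 * cyc n 2 (n - 3) = threeCycle n 0 3 2 * (cyc n 0 2 * cyc n 3 (n - 4)) := by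
  have e : cyc n 2 (n - 3) = sw n 2 3 * cyc n 3 (n - 4) := by
    rw [show n - 3 = n - 4 + 1 by omega, cyc_succ_left (by omega)]
  have e1 : cyc n 0 1 = sw n 0 1 := by
    rw [cyc_succ (by omega), cyc_zero, one_mul]
  rw [e, e1, cyc_two (by omega), ← mul_assoc, ← mul_assoc]
  congr 1
  have : sw 6 0 1 * sw 6 2 3 = threeCycle 6 0 3 2 * threeCycle 6 0 1 2 := by decide +kernel
  simpa [extend_sw, extend_threeCycle] using congrArg (extend hn) this

/-- The quotient W X⁻¹ is the 3-cycle (0, 3, 2). Its conjugates under X and X² are (1, 4, 0) and (2,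
5, 1), and these three produce the initial consecutive 3-cycles. The element W shifts the points
from 2 on. -/
theorem alternatingGroup_le_of_cyc_mul_cyc (hn : 6 ≤ n) {H : Subgroup (Perm (Fin n))}
    (hX : cyc n 0 2 * cyc n 3 (n - 4) ∈ H) (hW : cyc n 0 1 * cyc n 2 (n - 3) ∈ H) :
    alternatingGroup (Fin n) ≤ H := by
  have hY : threeCycle n 0 3 2 ∈ H := by
    have := mul_mem hW (inv_mem hX)
    rwa [cyc_mul_cyc_eq hn, mul_inv_cancel_right] at this
  set X := cyc n 0 2 * cyc n 3 (n - 4) with hXdef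
  set W := cyc n 0 1 * cyc n 2 (n - 3) with hWdef
  have hs (x : Fin n) (h1 : 2 ≤ (x : ℕ)) (h2 : (x : ℕ) + 1 < n) : (W x : ℕ) = x + 1 := by
    rw [hWdef, Perm.mul_apply, cyc_apply (by omega), cyc_apply (by omega)]
    split_ifs <;> omega
  have s (i j : ℕ) (h1 : i < n) (h : i < 2 ∧ j = i + 1 ∨ i = 2 ∧ j = 0 ∨
      3 ≤ i ∧ i + 1 < n ∧ j = i + 1) : (X ⟨i, h1⟩ : ℕ) = j := by
    rw [hXdef, Perm.mul_apply, cyc_apply (by omega), cyc_apply (by omega)]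
    dsimp only
    split_ifs <;> omega
  have hY1 : threeCycle n 1 4 0 ∈ H := by
    rw [← conj_threeCycle X (by omega) (by omega) (by omega) (s 0 _ (by omega) (by omega))
      (s 3 _ (by omega) (by omega)) (s 2 _ (by omega) (by omega))]
    exact mul_mem (mul_mem hX hY) (inv_mem hX)
  have hY2 : threeCycle n 2 5 1 ∈ H := by
    rw [← conj_threeCycle X (by omega) (by omega) (by omega) (s 1 _ (by omega) (by omega))
      (s 4 _ (by omega) (by omega)) (s 0 _ (by omega) (by omega))]
    exact mul_mem (mul_mem hX hY1) (inv_mem hX)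
  rw [← extend_threeCycle hn (by omega) (by omega) (by omega), ← Subgroup.mem_comap] at hY hY1 hY2
  set A := threeCycle 6 0 3 2 with hAdef
  set B := threeCycle 6 1 4 0 with hBdef
  set C := threeCycle 6 2 5 1 with hCdef
  have e0 : threeCycle 6 0 1 2 = A * C⁻¹ * A⁻¹ * C := by decide +kernel
  have e1 : threeCycle 6 1 2 3 = B * A⁻¹ * B⁻¹ := by decide +kernel
  have e2 : threeCycle 6 2 3 4 = B⁻¹ * A⁻¹ * B := by decide +kernel
  have m0 : threeCycle 6 0 1 2 ∈ H.comap (extend hn) := by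
    rw [e0]
    exact mul_mem (mul_mem (mul_mem hY (inv_mem hY2)) (inv_mem hY)) hY2
  have m1 : threeCycle 6 1 2 3 ∈ H.comap (extend hn) := by
    rw [e1]
    exact mul_mem (mul_mem hY1 (inv_mem hY)) (inv_mem hY1)
  have m2 : threeCycle 6 2 3 4 ∈ H.comap (extend hn) := by
    rw [e2]
    exact mul_mem (mul_mem (inv_mem hY1) (inv_mem hY)) hY1
  rw [Subgroup.mem_comap, extend_threeCycle hn (by omega) (by omega) (by omega)] at m0 m1 m2
  refine alternatingGroup_le_of_threeCycle_mem fun i hi => ?_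
  obtain rfl | rfl | h : i = 0 ∨ i = 1 ∨ 2 ≤ i := by omega
  · exact m0
  · exact m1
  · exact threeCycle_mem_of_shift hW hs m2 i h hi

theorem alternatingGroup_eight_le {H : Subgroup (Perm (Fin 8))} {X Y : Perm (Fin 8)}
    (hX : X ∈ H) (hY : Y ∈ H) (eX : X = cyc 8 0 1 * cyc 8 2 5)
    (eY : Y = threeCycle 8 0 3 6 * threeCycle 8 1 7 2) : alternatingGroup (Fin 8) ≤ H := by
  have hs (x : Fin 8) (h1 : 2 ≤ (x : ℕ)) (h2 : (x : ℕ) + 1 < 8) : (X x : ℕ) = x + 1 := by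
    rw [eX, Perm.mul_apply, cyc_apply (by omega), cyc_apply (by omega)]
    split_ifs <;> omega
  have eX' : X = sw 8 0 1 * (sw 8 2 3 * sw 8 3 4 * sw 8 4 5 * sw 8 5 6 * sw 8 6 7) := by
    rw [eX]
    simp [cyc_succ, cyc_zero]
  have m0 : threeCycle 8 0 1 2 ∈ H := by
    have e : threeCycle 8 0 1 2 = Y * X * X * X * Y⁻¹ * X * Y⁻¹ * X⁻¹ * X⁻¹ * Y⁻¹ := by
      rw [eX', eY]; decide +kernel
    rw [e]
    exact mul_mem (mul_mem (mul_mem (mul_mem (mul_mem (mul_mem (mul_mem (mul_mem (mul_mem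
      hY hX) hX) hX) (inv_mem hY)) hX) (inv_mem hY)) (inv_mem hX)) (inv_mem hX)) (inv_mem hY)
  have m1 : threeCycle 8 1 2 3 ∈ H := by
    have e : threeCycle 8 1 2 3 = X * Y * X⁻¹ * Y⁻¹ * X * Y * X⁻¹ * Y⁻¹ := by
      rw [eX', eY]; decide +kernel
    rw [e]
    exact mul_mem (mul_mem (mul_mem (mul_mem (mul_mem (mul_mem (mul_mem
      hX hY) (inv_mem hX)) (inv_mem hY)) hX) hY) (inv_mem hX)) (inv_mem hY)
  have m2 : threeCycle 8 2 3 4 ∈ H := by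
    have e : threeCycle 8 2 3 4 = X⁻¹ * X⁻¹ * Y * X⁻¹ * Y * X := by
      rw [eX', eY]; decide +kernel
    rw [e]
    exact mul_mem (mul_mem (mul_mem (mul_mem (mul_mem (inv_mem hX) (inv_mem hX)) hY) (inv_mem hX))
      hY) hX
  refine alternatingGroup_le_of_threeCycle_mem fun i hi => ?_
  obtain rfl | rfl | h : i = 0 ∨ i = 1 ∨ 2 ≤ i := by omega
  · exact m0
  · exact m1
  · exact threeCycle_mem_of_shift hX hs m2 i h hi

end DoubleCover

/-! ### Criteria for hyperbolic triples and Beauville structures. -/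

/-- The bound on the sum excludes (3, 3, 3), so the reciprocals add up to at most 1/4 + 1/3 + 1/3.
-/
theorem one_div_add_lt_one {a b c : ℕ} (ha : 3 ≤ a) (hb : 3 ≤ b) (hc : 3 ≤ c)
    (h : 10 ≤ a + b + c) : (1 : ℚ) / a + 1 / b + 1 / c < 1 := by
  have key (k m : ℕ) (hm : 0 < m) (h : m ≤ k) : (1 : ℚ) / k ≤ 1 / m :=
    one_div_le_one_div_of_le (by exact_mod_cast hm) (by exact_mod_cast h)
  have h1 := key a 3 (by norm_num) ha
  have h2 := key b 3 (by norm_num) hb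
  have h3 := key c 3 (by norm_num) hc
  obtain h4 | h4 | h4 : 4 ≤ a ∨ 4 ≤ b ∨ 4 ≤ c := by omega
  all_goals
    have h5 := key _ 4 (by norm_num) h4
    norm_num at h1 h2 h3 h5 ⊢
    linarith

theorem IsHyperbolicTriple.rotate {G : Type*} [Group G] {x y z : G} (h : IsHyperbolicTriple x y z) :
    IsHyperbolicTriple y z x := by
  refine ⟨?_, ?_, ?_⟩
  · rw [← h.closure_eq_top]
    congr 1
    ext u
    simp only [Set.mem_insert_iff, Set.mem_singleton_iff]
    tauto
  · rw [show y * z * x = x⁻¹ * (x * y * z) * x by group, h.mul_eq_one, mul_one, inv_mul_cancel]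
  · have := h.sum_lt_one
    linarith

theorem HasHyperbolicTripleOfType.rotate {G : Type*} [Group G] {k l m : ℕ}
    (h : HasHyperbolicTripleOfType G k l m) : HasHyperbolicTripleOfType G l m k := by
  obtain ⟨x, y, z, h, hx, hy, hz⟩ := h
  exact ⟨y, z, x, h.rotate, hy, hz, hx⟩

namespace DoubleCover

variable {n : ℕ}

theorem isHyperbolicTriple_alternatingGroup {x y z : alternatingGroup (Fin n)}
    (hgen : ∀ H : Subgroup (Perm (Fin n)), (x : Perm (Fin n)) ∈ H → (y : Perm (Fin n)) ∈ H →
      (z : Perm (Fin n)) ∈ H → alternatingGroup (Fin n) ≤ H)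
    (hm : x * y * z = 1) (hx : 3 ≤ orderOf x) (hy : 3 ≤ orderOf y) (hz : 3 ≤ orderOf z)
    (h : 10 ≤ orderOf x + orderOf y + orderOf z) : IsHyperbolicTriple x y z := by
  refine ⟨?_, hm, one_div_add_lt_one hx hy hz h⟩
  have mem (u : alternatingGroup (Fin n)) (hu : u ∈ ({x, y, z} : Set (alternatingGroup (Fin n)))) :
      (u : Perm (Fin n)) ∈
        (Subgroup.closure {x, y, z}).map (alternatingGroup (Fin n)).subtype :=
    Subgroup.mem_map_of_mem _ (Subgroup.subset_closure hu)
  have := hgen _ (mem x (by simp)) (mem y (by simp)) (mem z (by simp))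
  rw [eq_top_iff]
  intro u _
  obtain ⟨v, hv, e⟩ := this u.2
  rwa [← Subtype.ext e]

/-- Conjugate permutations move equally many points, so disjoint sets of counts rule out conjugacy.
-/
theorem isBeauvilleStructure_of_powersMove {x₁ y₁ z₁ x₂ y₂ z₂ : alternatingGroup (Fin n)}
    (h₁ : IsHyperbolicTriple x₁ y₁ z₁) (h₂ : IsHyperbolicTriple x₂ y₂ z₂) {S T : Set ℕ}
    (hS : ∀ u ∈ ({x₁, y₁, z₁} : Set (alternatingGroup (Fin n))), PowersMove S (u : Perm (Fin n)))
    (hT : ∀ u ∈ ({x₂, y₂, z₂} : Set (alternatingGroup (Fin n))), PowersMove T (u : Perm (Fin n)))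
    (hST : Disjoint S T) : IsBeauvilleStructure x₁ y₁ z₁ x₂ y₂ z₂ := by
  refine ⟨h₁, h₂, fun u hu v hv a b hne hc => ?_⟩
  have h1 : (u : Perm (Fin n)) ^ a ≠ 1 := by
    intro h
    exact hne (Subtype.ext (by simpa using h))
  have h2 : (v : Perm (Fin n)) ^ b ≠ 1 := by
    intro h
    have : v ^ b = 1 := Subtype.ext (by simpa using h)
    rw [this, isConj_one_left] at hc
    exact hne hc
  obtain ⟨g, hg⟩ := isConj_iff.mp hc
  have h3 := congrArg Subtype.val hg
  simp only [Subgroup.coe_mul, Subgroup.coe_inv, Subgroup.coe_zpow] at h3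
  have h4 := hS u hu a h1
  have h5 := hT v hv b h2
  rw [← h3, Perm.card_support_conj] at h5
  exact Set.disjoint_left.mp hST h4 h5

/-- If w^k = z, then zw has k-th power z^k z = 1 because k is odd. Replacing w by zw changes no
commutator with w, since z is central. -/
theorem exists_lift_pow_eq_one {w : TwoSym n} {k : ℕ} (hk : Odd k) (h : proj n w ^ k = 1) :
    ∃ w' : TwoSym n, proj n w' = proj n w ∧ w' ^ k = 1 ∧ ∀ g, w' * g * w'⁻¹ = w * g * w⁻¹ := by
  rcases eq_one_or_eq_zg (w := w ^ k) (by rw [map_pow, h]) with e | e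
  · exact ⟨w, rfl, e, fun _ => rfl⟩
  · refine ⟨zg n * w, by rw [map_mul, proj_zg, one_mul], ?_, fun g => ?_⟩
    · rw [(commute_zg w).mul_pow, e, zg_pow_odd hk, zg_mul_self]
    · rw [mul_inv_rev, zg_inv, ← (commute_zg (w⁻¹)).eq, mul_assoc (zg n), mul_assoc (zg n),
        ← mul_assoc (w * g) (zg n), ← (commute_zg (w * g)).eq, mul_assoc (zg n), ← mul_assoc (zg n),
        zg_mul_self, one_mul]

theorem orderOf_eq_of_proj {w : TwoSym n} {k : ℕ} (h : w ^ k = 1) (ho : orderOf (proj n w) = k) :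
    orderOf w = k :=
  Nat.dvd_antisymm (orderOf_dvd_of_pow_eq_one h) (ho ▸ orderOf_map_dvd (proj n) w)

/-- The hyperbolic triple `([w, g], g w g⁻¹, w⁻¹)` of `2·Alt(n)`. -/
theorem exists_commutator_triple {w g : TwoSym n} {k m : ℕ} {S : Set ℕ}
    (hw : Perm.sign (proj n w) = 1) (hwk : w ^ k = 1) (ho : orderOf (proj n w) = k)
    (hm : (w * g * w⁻¹ * g⁻¹) ^ m = 1) (hom : orderOf (proj n (w * g * w⁻¹ * g⁻¹)) = m)
    (hSw : PowersMove S (proj n w)) (hSm : PowersMove S (proj n (w * g * w⁻¹ * g⁻¹)))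
    (hgen : ∀ H : Subgroup (Perm (Fin n)), proj n w ∈ H → proj n (w * g * w⁻¹ * g⁻¹) ∈ H →
      alternatingGroup (Fin n) ≤ H) (hk3 : 3 ≤ k) (hm3 : 3 ≤ m) (hkm : 10 ≤ m + k + k) :
    ∃ x y z : TwoAlt n, x * y * z = 1 ∧ orderOf x = m ∧ orderOf y = k ∧ orderOf z = k ∧
      IsHyperbolicTriple (projAlt n x) (projAlt n y) (projAlt n z) ∧
      (∀ u ∈ ({x, y, z} : Set (TwoAlt n)), orderOf u = orderOf (projAlt n u)) ∧
      (∀ u ∈ ({projAlt n x, projAlt n y, projAlt n z} : Set (alternatingGroup (Fin n))),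
        PowersMove S (u : Perm (Fin n))) := by
  have hx : w * g * w⁻¹ * g⁻¹ ∈ TwoAlt n := by
    rw [mem_twoAlt]; simp [mul_comm, hw]
  have hy : g * w * g⁻¹ ∈ TwoAlt n := by
    rw [mem_twoAlt]; simp [mul_comm, hw]
  have hz : w⁻¹ ∈ TwoAlt n := by
    rw [mem_twoAlt]; simp [hw]
  have ox : orderOf (⟨_, hx⟩ : TwoAlt n) = m := by
    rw [Subgroup.orderOf_mk, orderOf_eq_of_proj hm hom]
  have oy : orderOf (⟨_, hy⟩ : TwoAlt n) = k := by
    rw [Subgroup.orderOf_mk, orderOf_conj', orderOf_eq_of_proj hwk ho]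
  have oz : orderOf (⟨_, hz⟩ : TwoAlt n) = k := by
    rw [Subgroup.orderOf_mk, orderOf_inv, orderOf_eq_of_proj hwk ho]
  have ox' : orderOf (projAlt n ⟨_, hx⟩) = m := by
    rw [← Subgroup.orderOf_coe, coe_projAlt, hom]
  have oy' : orderOf (projAlt n ⟨_, hy⟩) = k := by
    rw [← Subgroup.orderOf_coe, coe_projAlt, map_mul, map_mul, map_inv, orderOf_conj', ho]
  have oz' : orderOf (projAlt n ⟨_, hz⟩) = k := by
    rw [← Subgroup.orderOf_coe, coe_projAlt, map_inv, orderOf_inv, ho]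
  have hone : (⟨_, hx⟩ : TwoAlt n) * ⟨_, hy⟩ * ⟨_, hz⟩ = 1 := by
    ext
    simp only [Subgroup.coe_mul, Subgroup.coe_one]
    group
  refine ⟨⟨_, hx⟩, ⟨_, hy⟩, ⟨_, hz⟩, hone, ox, oy, oz, ?_, ?_, ?_⟩
  · refine isHyperbolicTriple_alternatingGroup ?_ ?_ ?_ ?_ ?_ ?_
    · intro H h1 _ h3
      rw [coe_projAlt] at h1 h3
      rw [map_inv, inv_mem_iff] at h3
      exact hgen H h3 h1
    · rw [← map_mul, ← map_mul, hone, map_one]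
    all_goals omega
  · rintro u (rfl | rfl | rfl)
    · rw [ox, ox']
    · rw [oy, oy']
    · rw [oz, oz']
  · rintro u (rfl | rfl | rfl) <;> rw [coe_projAlt]
    · exact hSm
    · rw [map_mul, map_mul, map_inv]
      exact hSw.conj _
    · rw [map_inv]
      exact hSw.inv

/-! ### Commutators of order 3 and 5 in the cover. -/

theorem mul_inv_pow_three {G : Type*} [Group G] {z a b : G} (hz : ∀ x, x * z = z * x)
    (hzz : z * z = 1) (ha : a * a = z) (hb : b * b = z) (hab : a * b * a = b * a * b) :
    (b * a⁻¹) ^ 3 = 1 := by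
  have ea : a⁻¹ = z * a := by
    rw [inv_eq_iff_mul_eq_one, ← mul_assoc, hz, mul_assoc, ha, hzz]
  have z1 (x : G) : z * (z * x) = x := by rw [← mul_assoc, hzz, one_mul]
  have az (x : G) : a * (z * x) = z * (a * x) := by rw [← mul_assoc, hz, mul_assoc]
  have bz (x : G) : b * (z * x) = z * (b * x) := by rw [← mul_assoc, hz, mul_assoc]
  have aa (x : G) : a * (a * x) = z * x := by rw [← mul_assoc, ha]
  have ba' (x : G) : b * (a * (b * x)) = a * (b * (a * x)) := by
    rw [← mul_assoc, ← mul_assoc, ← hab]; simp only [mul_assoc]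
  rw [ea, pow_three]
  simp only [mul_assoc, z1, az, bz, hz b, aa, ha, hb, ba', hzz]

/-- The image in the symmetric group is a 5-cycle; the point is that the fifth power is 1 and not z.
The relations are oriented as rewriting rules that bring z to the front and reduce the word. The
rules `cba1`, `dcb1` and `dcba1` are braid moves whose two equal letters are separated by letters
that they pass up to z. -/
theorem pow_five_eq_one {G : Type*} [Group G] {z a b c d : G} (hz : ∀ x, x * z = z * x)
    (hzz : z * z = 1) (ha : a * a = z) (hb : b * b = z) (hc : c * c = z) (hd : d * d = z)
    (hab : a * b * a = b * a * b) (hbc : b * c * b = c * b * c) (hcd : c * d * c = d * c * d)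
    (hca : c * a = z * (a * c)) (hda : d * a = z * (a * d)) (hdb : d * b = z * (b * d)) :
    (b * a * b * d * (a * c)⁻¹) ^ 5 = 1 := by
  have ea : a⁻¹ = z * a := by
    rw [inv_eq_iff_mul_eq_one, ← mul_assoc, hz, mul_assoc, ha, hzz]
  have ec : c⁻¹ = z * c := by
    rw [inv_eq_iff_mul_eq_one, ← mul_assoc, hz, mul_assoc, hc, hzz]
  have z1 (x : G) : z * (z * x) = x := by rw [← mul_assoc, hzz, one_mul]
  have lz (y x : G) : y * (z * x) = z * (y * x) := by rw [← mul_assoc, hz, mul_assoc]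
  have az := lz a
  have bz := lz b
  have cz := lz c
  have dz := lz d
  have aa (x : G) : a * (a * x) = z * x := by rw [← mul_assoc, ha]
  have bb (x : G) : b * (b * x) = z * x := by rw [← mul_assoc, hb]
  have cc (x : G) : c * (c * x) = z * x := by rw [← mul_assoc, hc]
  have dd (x : G) : d * (d * x) = z * x := by rw [← mul_assoc, hd]
  have ca (x : G) : c * (a * x) = z * (a * (c * x)) := by rw [← mul_assoc, hca]; simp only [mul_assoc]
  have da (x : G) : d * (a * x) = z * (a * (d * x)) := by rw [← mul_assoc, hda]; simp only [mul_assoc]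
  have db (x : G) : d * (b * x) = z * (b * (d * x)) := by rw [← mul_assoc, hdb]; simp only [mul_assoc]
  have ba1 (x : G) : b * (a * (b * x)) = a * (b * (a * x)) := by
    rw [← mul_assoc, ← mul_assoc, ← hab]; simp only [mul_assoc]
  have cb1 (x : G) : c * (b * (c * x)) = b * (c * (b * x)) := by
    rw [← mul_assoc, ← mul_assoc, ← hbc]; simp only [mul_assoc]
  have dc1 (x : G) : d * (c * (d * x)) = c * (d * (c * x)) := by
    rw [← mul_assoc, ← mul_assoc, ← hcd]; simp only [mul_assoc]
  have cba1 (x : G) : c * (b * (a * (c * x))) = z * (b * (c * (b * (a * x)))) := by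
    rw [← cb1, ca]; simp only [lz, z1]
  have dcb1 (x : G) : d * (c * (b * (d * x))) = z * (c * (d * (c * (b * x)))) := by
    rw [← dc1, db]; simp only [lz, z1]
  have dcba1 (x : G) : d * (c * (b * (a * (d * x)))) = c * (d * (c * (b * (a * x)))) := by
    rw [← dc1, db, da]; simp only [lz, z1]
  -- A trailing x gives every subword a right neighbour, so each rule is needed in one form only.
  suffices h : ∀ x, (b * a * b * d * (a * c)⁻¹) ^ 5 * x = x by simpa using h 1
  intro x
  rw [mul_inv_rev, ea, ec]
  simp only [pow_succ, pow_zero, one_mul, mul_assoc, z1, az, bz, cz, dz, aa, bb, cc, dd, ca, da, db,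
    ba1, cb1, dc1, cba1, dcb1, dcba1]

theorem threeCycle_eq_conj (hn : 6 ≤ n) :
    threeCycle n 0 3 2 = sw n 1 3 * cyc n 0 2 * (sw n 1 3)⁻¹ := by
  have : threeCycle 6 0 3 2 = sw 6 1 3 * threeCycle 6 0 1 2 * (sw 6 1 3)⁻¹ := by decide +kernel
  rw [cyc_two (by omega)]
  simpa only [map_mul, map_inv, extend_sw hn (show 1 < 6 by omega) (show 3 < 6 by omega),
    extend_threeCycle hn (show 0 < 6 by omega) (show 3 < 6 by omega) (show 2 < 6 by omega),
    extend_threeCycle hn (show 0 < 6 by omega) (show 1 < 6 by omega) (show 2 < 6 by omega)]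
    using congrArg (extend hn) this

theorem powersMove_threeCycle (hn : 6 ≤ n) : PowersMove {3} (threeCycle n 0 3 2) := by
  rw [threeCycle_eq_conj hn]
  exact (powersMove_cyc (by omega)).conj _

theorem orderOf_threeCycle (hn : 6 ≤ n) : orderOf (threeCycle n 0 3 2) = 3 := by
  rw [threeCycle_eq_conj hn, orderOf_conj', orderOf_cyc (by omega)]

/-! ### The hyperbolic triples. -/

theorem exists_triple_odd (hn : 7 ≤ n) (ho : Odd n) :
    ∃ x y z : TwoAlt n, x * y * z = 1 ∧ orderOf x = 3 ∧ orderOf y = n ∧ orderOf z = n ∧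
      IsHyperbolicTriple (projAlt n x) (projAlt n y) (projAlt n z) ∧
      (∀ u ∈ ({x, y, z} : Set (TwoAlt n)), orderOf u = orderOf (projAlt n u)) ∧
      (∀ u ∈ ({projAlt n x, projAlt n y, projAlt n z} : Set (alternatingGroup (Fin n))),
        PowersMove {3, n} (u : Perm (Fin n))) := by
  have hev : Even (n - 1) := by
    obtain ⟨k, rfl⟩ := ho
    simp
  have hoc : orderOf (cyc n 0 (n - 1)) = n := by
    rw [orderOf_cyc (by omega)]; omega
  obtain ⟨w, hw, hwn, hconj⟩ := exists_lift_pow_eq_one (w := run n 0 (n - 1)) ho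
    (by change cyc n 0 (n - 1) ^ n = 1; rw [← orderOf_dvd_iff_pow_eq_one, hoc])
  change proj n w = cyc n 0 (n - 1) at hw
  -- The run has the even length n - 1, so it conjugates t₀ to t₁ exactly, with no factor z.
  have hY : w * tg n 0 * w⁻¹ * (tg n 0)⁻¹ = tg n 1 * (tg n 0)⁻¹ := by
    rw [hconj]
    have := tg_succ_mul_run (n := n) (a := 0) (m := n - 1) (i := 0) le_rfl (by omega) (by omega)
    rw [zg_pow_even hev, one_mul] at this
    rw [← this, mul_inv_cancel_right]
  have hp : proj n (w * tg n 0 * w⁻¹ * (tg n 0)⁻¹) = (cyc n 0 2)⁻¹ := by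
    rw [hY, map_mul, map_inv, proj_tg (by omega), proj_tg (by omega), ← sw_eq, ← sw_eq,
      cyc_two (by omega), threeCycle, mul_inv_rev, inv_eq_of_mul_eq_one_left (sw_mul_self 1 2)]
  have sub1 : ({n - 1 + 1} : Set ℕ) ⊆ {3, n} := by
    rintro _ rfl
    right
    exact (by omega : n - 1 + 1 = n)
  have sub2 : ({2 + 1} : Set ℕ) ⊆ {3, n} := by simp
  refine exists_commutator_triple (w := w) (g := tg n 0) ?_ hwn (hw ▸ hoc) ?_ ?_ ?_ ?_ ?_
    (by omega) (by omega) (by omega)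
  · rw [hw, sign_cyc (by omega), hev.neg_one_pow]
  · rw [hY]
    exact mul_inv_pow_three (fun x => ((commute_zg x).eq).symm) zg_mul_self
      (tg_mul_self (by omega)) (tg_mul_self (by omega)) (tg_braid (by omega))
  · rw [hp, orderOf_inv, orderOf_cyc (by omega)]
  · rw [hw]
    exact (powersMove_cyc (by omega)).mono sub1
  · rw [hp]
    exact (powersMove_cyc (by omega)).inv.mono sub2
  · intro H h1 h2
    rw [hp, inv_mem_iff, cyc_two (by omega)] at h2
    refine alternatingGroup_le_of_threeCycle_mem fun i hi => ?_
    refine threeCycle_mem_of_shift h1 (a := 0) (fun x _ hx => ?_) h2 i (Nat.zero_le i) hi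
    rw [hw, cyc_apply (by omega), if_pos (by omega)]

theorem exists_triple_even (hn : 6 ≤ n) (he : Even n) :
    ∃ x y z : TwoAlt n, x * y * z = 1 ∧ orderOf x = 5 ∧ orderOf y = n - 1 ∧ orderOf z = n - 1 ∧
      IsHyperbolicTriple (projAlt n x) (projAlt n y) (projAlt n z) ∧
      (∀ u ∈ ({x, y, z} : Set (TwoAlt n)), orderOf u = orderOf (projAlt n u)) ∧
      (∀ u ∈ ({projAlt n x, projAlt n y, projAlt n z} : Set (alternatingGroup (Fin n))),
        PowersMove {5, n - 1} (u : Perm (Fin n))) := by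
  have hev : Even (n - 2) := by
    obtain ⟨k, rfl⟩ := he
    exact ⟨k - 1, by omega⟩
  have hodd : Odd (n - 1) := by
    rw [show n - 1 = n - 2 + 1 by omega]; exact hev.add_one
  have hodd' : Odd (n - 3) := by
    obtain ⟨k, rfl⟩ := he
    exact ⟨k - 2, by omega⟩
  have hoc : orderOf (cyc n 1 (n - 2)) = n - 1 := by
    rw [orderOf_cyc (by omega)]; omega
  obtain ⟨w, hw, hwn, hconj⟩ := exists_lift_pow_eq_one (w := run n 1 (n - 2)) hodd
    (by change cyc n 1 (n - 2) ^ (n - 1) = 1; rw [← orderOf_dvd_iff_pow_eq_one, hoc])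
  change proj n w = cyc n 1 (n - 2) at hw
  have hY : w * (tg n 0 * tg n 2) * w⁻¹ * (tg n 0 * tg n 2)⁻¹ =
      tg n 1 * tg n 0 * tg n 1 * tg n 3 * (tg n 0 * tg n 2)⁻¹ := by
    congr 1
    have h2 := tg_succ_mul_run (n := n) (a := 1) (m := n - 2) (i := 2) (by omega) (by omega)
      (by omega)
    rw [zg_pow_even hev, one_mul] at h2
    -- Two factors z cancel: one from t₁² = z, the other from moving t₀ past the odd number n - 3 of
    -- remaining letters.
    have h0 : tg n 1 * tg n 0 * tg n 1 * run n 1 (n - 2) = run n 1 (n - 2) * tg n 0 := by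
      have h3 := tg_mul_run_of_lt (n := n) (a := 2) (m := n - 3) (i := 0) (by omega) (by omega)
      rw [zg_pow_odd hodd'] at h3
      rw [show n - 2 = n - 3 + 1 by omega, run_succ_left]
      calc tg n 1 * tg n 0 * tg n 1 * (tg n 1 * run n 2 (n - 3))
          = tg n 1 * (tg n 0 * (tg n 1 * tg n 1) * run n 2 (n - 3)) := by simp only [mul_assoc]
        _ = tg n 1 * (zg n * (tg n 0 * run n 2 (n - 3))) := by
          rw [tg_mul_self (by omega), ← (commute_zg (tg n 0)).eq, mul_assoc]
        _ = _ := by rw [h3, ← mul_assoc (zg n), zg_mul_self, one_mul, mul_assoc]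
    rw [hconj, mul_inv_eq_iff_eq_mul, ← mul_assoc, ← h0, mul_assoc, ← h2]
    simp only [mul_assoc]
  have hp1 : proj n (w * (tg n 0 * tg n 2) * w⁻¹ * (tg n 0 * tg n 2)⁻¹) =
      sw n 0 2 * sw n 3 4 * (sw n 0 1 * sw n 2 3) := by
    rw [hY]
    simp only [map_mul, map_inv]
    rw [proj_tg (i := 0) (by omega), proj_tg (i := 1) (by omega), proj_tg (i := 2) (by omega),
      proj_tg (i := 3) (by omega), ← sw_eq, ← sw_eq, ← sw_eq, ← sw_eq]
    have : sw 6 1 2 * sw 6 0 1 * sw 6 1 2 * sw 6 3 4 * (sw 6 0 1 * sw 6 2 3)⁻¹ =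
      sw 6 0 2 * sw 6 3 4 * (sw 6 0 1 * sw 6 2 3) := by decide +kernel
    simpa [extend_sw] using congrArg (extend hn) this
  have hp2 : sw n 0 2 * sw n 3 4 * (sw n 0 1 * sw n 2 3) =
      sw n 3 4 * cyc n 0 4 * (sw n 3 4)⁻¹ := by
    have : sw 6 0 2 * sw 6 3 4 * (sw 6 0 1 * sw 6 2 3) =
      sw 6 3 4 * (sw 6 0 1 * sw 6 1 2 * sw 6 2 3 * sw 6 3 4) * (sw 6 3 4)⁻¹ := by decide +kernel
    rw [cyc_four (by omega)]
    simpa only [map_mul, map_inv, extend_sw hn (show 0 < 6 by omega) (show 2 < 6 by omega),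
      extend_sw hn (show 3 < 6 by omega) (show 4 < 6 by omega),
      extend_sw hn (show 0 < 6 by omega) (show 1 < 6 by omega),
      extend_sw hn (show 1 < 6 by omega) (show 2 < 6 by omega),
      extend_sw hn (show 2 < 6 by omega) (show 3 < 6 by omega)]
      using congrArg (extend hn) this
  have sub1 : ({n - 2 + 1} : Set ℕ) ⊆ {5, n - 1} := by
    rintro _ rfl
    right
    exact (by omega : n - 2 + 1 = n - 1)
  have sub2 : ({4 + 1} : Set ℕ) ⊆ {5, n - 1} := by simp
  refine exists_commutator_triple (w := w) (g := tg n 0 * tg n 2) ?_ hwn (hw ▸ hoc) ?_ ?_ ?_ ?_ ?_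
    (by omega) (by omega) (by omega)
  · rw [hw, sign_cyc (by omega), hev.neg_one_pow]
  · rw [hY]
    exact pow_five_eq_one (fun x => ((commute_zg x).eq).symm) zg_mul_self
      (tg_mul_self (by omega)) (tg_mul_self (by omega)) (tg_mul_self (by omega))
      (tg_mul_self (by omega)) (tg_braid (by omega)) (tg_braid (by omega)) (tg_braid (by omega))
      (tg_far (by omega) (by omega)) (tg_far (by omega) (by omega)) (tg_far (by omega) (by omega))
  · rw [hp1, hp2, orderOf_conj', orderOf_cyc (by omega)]
  · rw [hw]
    exact (powersMove_cyc (by omega)).mono sub1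
  · rw [hp1, hp2]
    exact ((powersMove_cyc (by omega)).conj _).mono sub2
  · intro H h1 h2
    rw [hp1] at h2
    rw [hw] at h1
    exact alternatingGroup_le_of_fiveCycle hn h1 h2

theorem exists_alternating_triple_odd (hn : 7 ≤ n) (ho : Odd n) :
    ∃ x y z : alternatingGroup (Fin n), IsHyperbolicTriple x y z ∧ orderOf x = n - 2 ∧
      orderOf y = n - 2 ∧ orderOf z = 5 ∧
      ∀ u ∈ ({x, y, z} : Set (alternatingGroup (Fin n))),
        PowersMove {5, n - 2} (u : Perm (Fin n)) := by
  have hev : Even (n - 3) := by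
    obtain ⟨k, rfl⟩ := ho
    exact ⟨k - 1, by omega⟩
  set X := cyc n 2 (n - 3) with hX
  -- With this g the commutator [X, g] is the 5-cycle (0, 1, 2, 3, 4), and the triple is (X, g X⁻¹
  -- g⁻¹, [X, g]⁻¹).
  set g := sw n 1 2 * sw n 0 3 with hg
  have hoX : orderOf X = n - 2 := by
    rw [hX, orderOf_cyc (by omega)]; omega
  have hsX : Perm.sign X = 1 := by
    rw [hX, sign_cyc (by omega), hev.neg_one_pow]
  have hY : X * g * X⁻¹ * g⁻¹ = cyc n 0 4 := by
    have h0 (i j : ℕ) (h : i < n) (h' : i < 2 ∧ j = i ∨ 2 ≤ i ∧ i + 1 < n ∧ j = i + 1) :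
        (X ⟨i, h⟩ : ℕ) = j := by
      rw [hX, cyc_apply (by omega)]
      dsimp only
      split_ifs <;> omega
    rw [hg, conj_mul', conj_sw X (by omega) (by omega) (h0 1 1 (by omega) (by omega))
      (h0 2 3 (by omega) (by omega)), conj_sw X (by omega) (by omega)
      (h0 0 0 (by omega) (by omega)) (h0 3 4 (by omega) (by omega)), cyc_four (by omega)]
    have : sw 7 1 3 * sw 7 0 4 * (sw 7 1 2 * sw 7 0 3)⁻¹ =
      sw 7 0 1 * sw 7 1 2 * sw 7 2 3 * sw 7 3 4 := by decide +kernel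
    simpa [extend_sw] using congrArg (extend hn) this
  have hx : X ∈ alternatingGroup (Fin n) := hsX
  have hy : g * X⁻¹ * g⁻¹ ∈ alternatingGroup (Fin n) := by
    change Perm.sign _ = 1
    simp [mul_comm, hsX]
  have hz : (cyc n 0 4)⁻¹ ∈ alternatingGroup (Fin n) := by
    change Perm.sign _ = 1
    rw [map_inv, sign_cyc (by omega)]; rfl
  have ox : orderOf (⟨X, hx⟩ : alternatingGroup (Fin n)) = n - 2 := by
    rw [Subgroup.orderOf_mk, hoX]
  have oy : orderOf (⟨_, hy⟩ : alternatingGroup (Fin n)) = n - 2 := by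
    rw [Subgroup.orderOf_mk, orderOf_conj', orderOf_inv, hoX]
  have oz : orderOf (⟨_, hz⟩ : alternatingGroup (Fin n)) = 5 := by
    rw [Subgroup.orderOf_mk, orderOf_inv, orderOf_cyc (by omega)]
  have sub1 : ({n - 3 + 1} : Set ℕ) ⊆ {5, n - 2} := by
    rintro _ rfl
    right
    exact (by omega : n - 3 + 1 = n - 2)
  have sub2 : ({4 + 1} : Set ℕ) ⊆ {5, n - 2} := by simp
  have hpX : PowersMove {5, n - 2} X := (powersMove_cyc (by omega)).mono sub1
  refine ⟨⟨X, hx⟩, ⟨_, hy⟩, ⟨_, hz⟩, ?_, ox, oy, oz, ?_⟩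
  · refine isHyperbolicTriple_alternatingGroup ?_ ?_ ?_ ?_ ?_ ?_
    · intro H h1 _ h3
      exact alternatingGroup_le_of_cyc_four hn h1 (inv_mem_iff.mp h3)
    · ext1
      change X * (g * X⁻¹ * g⁻¹) * (cyc n 0 4)⁻¹ = 1
      rw [← hY]
      group
    all_goals omega
  · rintro u (rfl | rfl | rfl)
    · exact hpX
    · exact hpX.inv.conj g
    · exact (powersMove_cyc (by omega)).inv.mono sub2

/-- The triple is (X, W⁻¹, Y) with X = (0, 1, 2)(3, …, n-1), W = (0, 1)(2, …, n-1) and Y = (0, 3,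
2), where W = Y X. Since n is even, X and W are even and lcm(2, n-2) = n - 2. -/
theorem exists_alternating_triple_even (hn : 6 ≤ n) (he : Even n) :
    ∃ x y z : alternatingGroup (Fin n), IsHyperbolicTriple x y z ∧ orderOf x = Nat.lcm 3 (n - 3) ∧
      orderOf y = n - 2 ∧ orderOf z = 3 ∧
      ∀ u ∈ ({x, y, z} : Set (alternatingGroup (Fin n))),
        PowersMove {2, 3, n - 3, n - 2, n} (u : Perm (Fin n)) := by
  have hev : Even (n - 4) := by
    obtain ⟨k, rfl⟩ := he
    exact ⟨k - 2, by omega⟩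
  have hodd : Odd (n - 3) := by
    rw [show n - 3 = n - 4 + 1 by omega]; exact hev.add_one
  have hXW := cyc_mul_cyc_eq hn
  have dX : (cyc n 0 2).Disjoint (cyc n 3 (n - 4)) := disjoint_cyc (by omega) (by omega)
  have dW : (cyc n 0 1).Disjoint (cyc n 2 (n - 3)) := disjoint_cyc (by omega) (by omega)
  have hgen (H : Subgroup (Perm (Fin n))) := alternatingGroup_le_of_cyc_mul_cyc hn (H := H)
  have hoX : orderOf (cyc n 0 2 * cyc n 3 (n - 4)) = Nat.lcm 3 (n - 3) := by
    rw [dX.orderOf, orderOf_cyc (by omega), orderOf_cyc (by omega)]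
    congr 1; omega
  have hoW : orderOf (cyc n 0 1 * cyc n 2 (n - 3)) = n - 2 := by
    rw [dW.orderOf, orderOf_cyc (by omega), orderOf_cyc (by omega)]
    rw [show n - 3 + 1 = n - 2 by omega]
    refine Nat.lcm_eq_right (even_iff_two_dvd.mp ?_)
    rw [show n - 2 = n - 3 + 1 by omega]; exact hodd.add_one
  have pX : PowersMove {2, 3, n - 3, n - 2, n} (cyc n 0 2 * cyc n 3 (n - 4)) := by
    refine ((powersMove_cyc (by omega)).mul (powersMove_cyc (by omega)) dX).mono ?_
    rintro k ((h | h) | ⟨_, rfl, _, rfl, h⟩) <;>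
      simp only [Set.mem_insert_iff, Set.mem_singleton_iff] at h ⊢ <;> omega
  have pW : PowersMove {2, 3, n - 3, n - 2, n} (cyc n 0 1 * cyc n 2 (n - 3)) := by
    refine ((powersMove_cyc (by omega)).mul (powersMove_cyc (by omega)) dW).mono ?_
    rintro k ((h | h) | ⟨_, rfl, _, rfl, h⟩) <;>
      simp only [Set.mem_insert_iff, Set.mem_singleton_iff] at h ⊢ <;> omega
  have hx : cyc n 0 2 * cyc n 3 (n - 4) ∈ alternatingGroup (Fin n) := by
    change Perm.sign _ = 1
    rw [map_mul, sign_cyc (by omega), sign_cyc (by omega), hev.neg_one_pow]; rfl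
  have hw : cyc n 0 1 * cyc n 2 (n - 3) ∈ alternatingGroup (Fin n) := by
    change Perm.sign _ = 1
    rw [map_mul, sign_cyc (by omega), sign_cyc (by omega), hodd.neg_one_pow]; rfl
  have hz : threeCycle n 0 3 2 ∈ alternatingGroup (Fin n) := by
    have := mul_mem hw (inv_mem hx)
    rwa [hXW, mul_inv_cancel_right] at this
  have ox : orderOf (⟨_, hx⟩ : alternatingGroup (Fin n)) = Nat.lcm 3 (n - 3) := by
    rw [Subgroup.orderOf_mk, hoX]
  have oy : orderOf (⟨_, inv_mem hw⟩ : alternatingGroup (Fin n)) = n - 2 := by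
    rw [Subgroup.orderOf_mk, orderOf_inv, hoW]
  have oz : orderOf (⟨_, hz⟩ : alternatingGroup (Fin n)) = 3 := by
    rw [Subgroup.orderOf_mk, orderOf_threeCycle hn]
  have h3 : 3 ≤ Nat.lcm 3 (n - 3) :=
    Nat.le_of_dvd (Nat.lcm_pos (by omega) (by omega)) (Nat.dvd_lcm_left _ _)
  refine ⟨⟨_, hx⟩, ⟨_, inv_mem hw⟩, ⟨_, hz⟩, ?_, ox, oy, oz, ?_⟩
  · refine isHyperbolicTriple_alternatingGroup ?_ ?_ ?_ ?_ ?_ ?_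
    · intro H h1 h2 _
      exact hgen H h1 (inv_mem_iff.mp h2)
    · ext1
      change cyc n 0 2 * cyc n 3 (n - 4) * (cyc n 0 1 * cyc n 2 (n - 3))⁻¹ * threeCycle n 0 3 2 = 1
      rw [hXW]
      group
    all_goals omega
  · rintro u (rfl | rfl | rfl)
    · exact pX
    · exact pW.inv
    · exact (powersMove_threeCycle hn).mono (by simp)

/-- A triple of type (6, 3, 6) none of whose non-identity powers moves 5 or 7 points. -/
theorem exists_alternating_triple_eight :
    ∃ x y z : alternatingGroup (Fin 8), IsHyperbolicTriple x y z ∧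
      ∀ u ∈ ({x, y, z} : Set (alternatingGroup (Fin 8))),
        PowersMove {2, 3, 6, 8} (u : Perm (Fin 8)) := by
  have dX : (cyc 8 0 1).Disjoint (cyc 8 2 5) := disjoint_cyc (by omega) (by omega)
  have dY : (cyc 8 0 2).Disjoint (cyc 8 3 2) := disjoint_cyc (by omega) (by omega)
  have eX : cyc 8 0 1 * cyc 8 2 5 =
      sw 8 0 1 * (sw 8 2 3 * sw 8 3 4 * sw 8 4 5 * sw 8 5 6 * sw 8 6 7) := by
    simp [cyc_succ, cyc_zero]
  have eY : cyc 8 0 2 * cyc 8 3 2 = threeCycle 8 0 1 2 * threeCycle 8 3 4 5 := by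
    simp [cyc_succ, cyc_zero, threeCycle]
  have oX : orderOf (cyc 8 0 1 * cyc 8 2 5) = 6 := by
    rw [dX.orderOf, orderOf_cyc (by omega), orderOf_cyc (by omega)]; rfl
  have oY : orderOf (cyc 8 0 2 * cyc 8 3 2) = 3 := by
    rw [dY.orderOf, orderOf_cyc (by omega), orderOf_cyc (by omega)]; rfl
  have pX : PowersMove {2, 3, 6, 8} (cyc 8 0 1 * cyc 8 2 5) := by
    refine ((powersMove_cyc (by omega)).mul (powersMove_cyc (by omega)) dX).mono ?_
    rintro k ((h | h) | ⟨_, rfl, _, rfl, h⟩) <;>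
      simp only [Set.mem_insert_iff, Set.mem_singleton_iff] at h ⊢ <;> omega
  have pY : PowersMove {2, 3, 6, 8} (cyc 8 0 2 * cyc 8 3 2) := by
    refine ((powersMove_cyc (by omega)).mul (powersMove_cyc (by omega)) dY).mono ?_
    rintro k ((h | h) | ⟨_, rfl, _, rfl, h⟩) <;>
      simp only [Set.mem_insert_iff, Set.mem_singleton_iff] at h ⊢ <;> omega
  have sX : Perm.sign (cyc 8 0 1 * cyc 8 2 5) = 1 := by
    rw [map_mul, sign_cyc (by omega), sign_cyc (by omega)]; rfl
  have sY : Perm.sign (cyc 8 0 2 * cyc 8 3 2) = 1 := by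
    rw [map_mul, sign_cyc (by omega), sign_cyc (by omega)]; rfl
  set X := cyc 8 0 1 * cyc 8 2 5 with hX
  set Y₀ := cyc 8 0 2 * cyc 8 3 2 with hY₀
  -- The conjugators h and g exhibit the cycle types of Y and XY, so that orders and moved points
  -- can be read off from cycles on consecutive points.
  set h := sw 8 1 3 * (sw 8 2 6 * sw 8 6 4 * sw 8 4 7 * sw 8 7 5) with hh
  set g := sw 8 0 3 * sw 8 3 4 * sw 8 4 5 * sw 8 5 6 * sw 8 6 1 * sw 8 1 7 * sw 8 7 2 with hg
  have hY : h * Y₀ * h⁻¹ = threeCycle 8 0 3 6 * threeCycle 8 1 7 2 := by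
    rw [eY, hh]; decide +kernel
  have hXY : X * (h * Y₀ * h⁻¹) = g * X * g⁻¹ := by
    rw [hY, eX, hg]; decide +kernel
  have hx : X ∈ alternatingGroup (Fin 8) := sX
  have hy : h * Y₀ * h⁻¹ ∈ alternatingGroup (Fin 8) := by
    change Perm.sign _ = 1
    simp [mul_comm, sY]
  have hz : (g * X * g⁻¹)⁻¹ ∈ alternatingGroup (Fin 8) := by
    change Perm.sign _ = 1
    simp [sX]
  have ox : orderOf (⟨_, hx⟩ : alternatingGroup (Fin 8)) = 6 := by
    rw [Subgroup.orderOf_mk, oX]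
  have oy : orderOf (⟨_, hy⟩ : alternatingGroup (Fin 8)) = 3 := by
    rw [Subgroup.orderOf_mk, orderOf_conj', oY]
  have oz : orderOf (⟨_, hz⟩ : alternatingGroup (Fin 8)) = 6 := by
    rw [Subgroup.orderOf_mk, orderOf_inv, orderOf_conj', oX]
  refine ⟨⟨_, hx⟩, ⟨_, hy⟩, ⟨_, hz⟩, ?_, ?_⟩
  · refine isHyperbolicTriple_alternatingGroup ?_ ?_ ?_ ?_ ?_ ?_
    · intro H h1 h2 _
      exact alternatingGroup_eight_le h1 h2 hX hY
    · ext1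
      change X * (h * Y₀ * h⁻¹) * (g * X * g⁻¹)⁻¹ = 1
      rw [hXY, mul_inv_cancel]
    all_goals omega
  · rintro u (rfl | rfl | rfl)
    · exact pX
    · exact pY.conj h
    · exact (pX.conj g).inv

end DoubleCover
open DoubleCover

theorem mainTheorem11 (n : ℕ) (hn : 6 ≤ n) :
    IsBeauvilleGroup (TwoAlt n) ∧
    IsBeauvilleGroup (TwoAlt n ⧸ Subgroup.center (TwoAlt n)) ∧
    IsBeauvilleGroup (alternatingGroup (Fin n)) ∧
    (Odd n → HasHyperbolicTripleOfType (TwoAlt n) n 3 n) ∧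
    (Even n → HasHyperbolicTripleOfType (TwoAlt n) 5 (n - 1) (n - 1)) ∧
    (Odd n → HasHyperbolicTripleOfType (alternatingGroup (Fin n)) (n - 2) (n - 2) 5) ∧
    (Even n →
      HasHyperbolicTripleOfType (alternatingGroup (Fin n)) (Nat.lcm 3 (n - 3)) (n - 2) 3) := by
  have lift {x y z : TwoAlt n} (hm : x * y * z = 1)
      (h : IsHyperbolicTriple (projAlt n x) (projAlt n y) (projAlt n z)) :
      IsHyperbolicTriple x y z := .of_map _ (eq_top_of_map_projAlt hn) h hm
  have main (h : ∃ x₁ y₁ z₁ : TwoAlt n, ∃ x₂ y₂ z₂ : alternatingGroup (Fin n), x₁ * y₁ * z₁ = 1 ∧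
      (∀ u ∈ ({x₁, y₁, z₁} : Set (TwoAlt n)), orderOf u = orderOf (projAlt n u)) ∧
      IsBeauvilleStructure (projAlt n x₁) (projAlt n y₁) (projAlt n z₁) x₂ y₂ z₂) :
      IsBeauvilleGroup (TwoAlt n) ∧
      IsBeauvilleGroup (TwoAlt n ⧸ Subgroup.center (TwoAlt n)) ∧
      IsBeauvilleGroup (alternatingGroup (Fin n)) := by
    obtain ⟨x₁, y₁, z₁, x₂, y₂, z₂, hm, ho, h⟩ := h
    have hA : IsBeauvilleGroup (alternatingGroup (Fin n)) := ⟨_, _, _, _, _, _, h⟩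
    exact ⟨h.isBeauvilleGroup_of_map (projAlt n) projAlt_surjective (eq_top_of_map_projAlt hn) hm ho,
      isBeauvilleGroup_quotient_center (by omega) hA, hA⟩
  rcases Nat.even_or_odd n with he | ho
  · have hno : ¬ Odd n := Nat.not_odd_iff_even.mpr he
    obtain ⟨x, y, z, hm, hx, hy, hz, h, ho, hS⟩ := exists_triple_even hn he
    obtain ⟨x', y', z', h', hx', hy', hz', hT⟩ := exists_alternating_triple_even hn he
    have hB := main <| by
      -- For n = 8 the count n - 3 of the general second triple equals 5, which also occurs in the
      -- first triple.
      by_cases h8 : n = 8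
      · subst h8
        obtain ⟨x', y', z', h', hT⟩ := exists_alternating_triple_eight
        refine ⟨x, y, z, x', y', z', hm, ho, isBeauvilleStructure_of_powersMove h h' hS hT ?_⟩
        rw [Set.disjoint_left]
        simp
      · refine ⟨x, y, z, x', y', z', hm, ho, isBeauvilleStructure_of_powersMove h h' hS hT ?_⟩
        rw [Set.disjoint_left]
        obtain ⟨k, rfl⟩ := he
        intro a
        simp only [Set.mem_insert_iff, Set.mem_singleton_iff]
        omega
    exact ⟨hB.1, hB.2.1, hB.2.2, fun h => absurd h hno, fun _ => ⟨x, y, z, lift hm h, hx, hy, hz⟩,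
      fun h => absurd h hno, fun _ => ⟨x', y', z', h', hx', hy', hz'⟩⟩
  · have hne : ¬ Even n := Nat.not_even_iff_odd.mpr ho
    have h7 : 7 ≤ n := by
      obtain ⟨k, rfl⟩ := ho
      omega
    obtain ⟨x, y, z, hm, hx, hy, hz, h, hord, hS⟩ := exists_triple_odd h7 ho
    obtain ⟨x', y', z', h', hx', hy', hz', hT⟩ := exists_alternating_triple_odd h7 ho
    have hB := main ⟨x, y, z, x', y', z', hm, hord, isBeauvilleStructure_of_powersMove h h' hS hT (by
      rw [Set.disjoint_left]
      intro a
      simp only [Set.mem_insert_iff, Set.mem_singleton_iff]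
      omega)⟩
    have ht : HasHyperbolicTripleOfType (TwoAlt n) 3 n n := ⟨x, y, z, lift hm h, hx, hy, hz⟩
    exact ⟨hB.1, hB.2.1, hB.2.2, fun _ => ht.rotate.rotate, fun h => absurd h hne,
      fun _ => ⟨x', y', z', h', hx', hy', hz'⟩, fun h => absurd h hne⟩
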